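/- **Definitions.** For an Ore domain $A$ let $\operatorname{Frac}A$ be its skew field of fractions and $Z(A)$ its centre. $A_n(K)$ is the Weyl algebra over $K$ (generators $x_1,\dots,x_n,y_1,\dots,y_n$, relations $[x_i,x_j]=[y_i,y_j]=0$, $[y_i,x_j]=\delta_{ij}$), and for a field $\mathbf k$ let $\mathbb D_{n,l}(\mathbf k)=\operatorname{Frac}A_n(\mathbf k(t_1,\dots,t_l))$. The Gelfand–Kirillov transcendence degree of a $\mathbf k$-algebra $D$ is $\operatorname{Tdeg}D=\sup_V\inf_b\,\limsup_{r\to\infty}\frac{\log\dim_{\mathbf k}(\mathbf k+bV)^r}{\log r}$, where $V$ ranges over the finite-dimensional subspaces and $b$ over the regular elements of $D$. Let $A_{\mathbb Z}$ be a ring and $A_{\mathbf k}=A_{\mathbb Z}\otimes_{\mathbb Z}\mathbf k$ for every algebraically closed field $\mathbf k$ of any characteristic. The family $\mathcal K=\{A_{\mathbf k}\}$ is *$\mathbb Z$-compatible* if: 1. $A_{\mathbb Z}$ and all $A_{\mathbf k}$ are Ore domains. 2. There is an exhaustive filtration $A_0\subseteq A_1\subseteq\cdots$ of $A_{\mathbb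 Z}$ such that $A_0=\mathbb Z$, such that $A_i=(A_1)^i$ is a finitely generated free abelian group for $i\ge1$, and such that $A_i^{\mathbf k}=A_i\otimes_{\mathbb Z}\mathbf k$ embeds in $A_{\mathbf k}$ for all $i$ and $\mathbf k$. Moreover, either $\operatorname{Tdeg}\operatorname{Frac}A_{\mathbf k}=\dim_{\mathbf k}A_1^{\mathbf k}$ for all $\mathbf k$, or $\operatorname{Tdeg}\operatorname{Frac}A_{\mathbf k}=\dim_{\mathbf k}A_1^{\mathbf k}-1$ (the dimension of $A_1^{\mathbf k}$ modulo scalars) for all $\mathbf k$. 3. For $\mathbf k$ of characteristic $0$, $Z(\operatorname{Frac}A_{\mathbf k})\cong\operatorname{Frac}Z(A_{\mathbf k})$ as $\mathbf k$-algebras. 4. There are $s\ge 0$ and $x_1,\dots,x_s\in A_{\mathbb Z}$ such that, for all $\mathbf k$ of characteristic $0$, $Z(A_{\mathbf k})$ is the polynomial algebra $\mathbf k[x_1,\dots,x_s]$ in the images of the $x_i$, and such that, for all $\mathbf k$ of prime characteristic, the images of the $x_i$ in $A_{\mathbf k}$ are central. For $\mathbf k$ of characteristic $0$, the *Gelfand–Kirillov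 Conjecture holds for $A_{\mathbf k}$* if $\operatorname{Frac}A_{\mathbf k}\cong\mathbb D_{n,l}(\mathbf k)$ as $\mathbf k$-algebras for some $n,l\ge0$ with $\operatorname{Tdeg}\operatorname{Frac}A_{\mathbf k}=2n+l$ and $l=\operatorname{trdeg}_{\mathbf k}\operatorname{Frac}Z(A_{\mathbf k})$. Elements $w_1,\dots,w_{2m}$ of $\operatorname{Frac}A_{\mathbf k}$ are *Weyl generators* if $[w_i,w_j]=[w_{m+i},w_{m+j}]=0$ and $[w_i,w_{m+j}]=\delta_{ij}$ for $1\le i,j\le m$, and every element of $\operatorname{Frac}A_{\mathbf k}$ has the form $q^{-1}p$ with $p$ and $q\neq0$ polynomials in the $w_i$ with coefficients in $Z(\operatorname{Frac}A_{\mathbf k})$. **Theorem.** Let $\{A_{\mathbf k}\}$ be a $\mathbb Z$-compatible family. Then there are $N\ge 0$ and finite sets $F,G\subset\mathbb Z[T_1,\dots,T_N]$, depending only on the family, such that for every algebraically closed field $\mathbf k$ of characteristic $0$ the locally closed subvariety $$X^{\mathbf k}=\{z\in\mathbf k^N:\ f(z)=0\ \text{for all } f\in F,\ \ g(z)\ne0\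 \text{for some } g\in G\}$$ of $\mathbf k^N$ satisfies: the Gelfand–Kirillov Conjecture holds for $A_{\mathbf k}$ if and only if $X^{\mathbf k}\neq\varnothing$. Moreover, $X^{\mathbf k}$ encodes Weyl generators: $F$ and $G$ can be chosen together with an $m\ge 0$ and elements $a_i,b_i\in\mathbb Z[T_1,\dots,T_N]\otimes_{\mathbb Z}A_{\mathbb Z}$ $(1\le i\le 2m)$ such that, for every such $\mathbf k$ and every $z\in X^{\mathbf k}$, the values $b_i(z)\in A_{\mathbf k}$ are nonzero and the elements $w_i=b_i(z)^{-1}a_i(z)$ are Weyl generators of $\operatorname{Frac}A_{\mathbf k}$. -/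

import Mathlib

open scoped TensorProduct nonZeroDivisors

universe u v

noncomputable section

/-! ## Ore domains and their skew fields of fractions -/

/-- A (two-sided) Ore domain: a not necessarily commutative domain in which any two nonzero
elements have a common nonzero left multiple and a common nonzero right multiple. -/
class IsOreDomain (A : Type*) [Ring A] : Prop extends IsDomain A where
  left_ore : ∀ a b : A, b ≠ 0 → ∃ c d : A, d ≠ 0 ∧ d * a = c * b
  right_ore : ∀ a b : A, b ≠ 0 → ∃ c d : A, d ≠ 0 ∧ a * d = b * c

/-- The nonzero elements of an Ore domain form an Ore set in the sense of Mathlib. -/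
instance (priority := low) IsOreDomain.oreSet (A : Type*) [Ring A] [h : IsOreDomain A] :
    OreLocalization.OreSet A⁰ :=
  OreLocalization.oreSetOfNoZeroDivisors
    (fun a b => (h.left_ore a b (nonZeroDivisors.coe_ne_zero b)).choose)
    (fun a b => ⟨(h.left_ore a b (nonZeroDivisors.coe_ne_zero b)).choose_spec.choose,
      mem_nonZeroDivisors_of_ne_zero
        (h.left_ore a b (nonZeroDivisors.coe_ne_zero b)).choose_spec.choose_spec.1⟩)
    (fun a b => (h.left_ore a b (nonZeroDivisors.coe_ne_zero b)).choose_spec.choose_spec.2)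

/-- `Frac A`, the skew field of fractions of an Ore domain `A`: the Ore localization of `A` at
all its nonzero elements. -/
abbrev SkewFrac (A : Type*) [Ring A] [IsOreDomain A] : Type _ :=
  @OreLocalization A _ A⁰ (IsOreDomain.oreSet A) A _

/-- The canonical embedding `A → Frac A`. -/
def SkewFrac.of (A : Type*) [Ring A] [IsOreDomain A] : A →+* SkewFrac A :=
  OreLocalization.numeratorRingHom

/-- `ι : A → D` exhibits the division ring `D` as a skew field of fractions of `A`:
`ι` is injective and each element of `D` has the form `ι(b)⁻¹ ι(a)` with `b ≠ 0`. -/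
structure IsSkewFieldOfFractions {A D : Type*} [Ring A] [DivisionRing D] (ι : A →+* D) :
    Prop where
  injective : Function.Injective ι
  exists_frac : ∀ d : D, ∃ a b : A, b ≠ 0 ∧ d = (ι b)⁻¹ * ι a

/-! ## Weyl algebras and Weyl fields -/

/-- The defining relations of the `n`-th Weyl algebra; `Sum.inl i` is the index of `x_i` and
`Sum.inr i` is the index of `y_i`. -/
inductive WeylRel (n : ℕ) (K : Type*) [CommRing K] :
    FreeAlgebra K (Fin n ⊕ Fin n) → FreeAlgebra K (Fin n ⊕ Fin n) → Prop
  | xx (i j : Fin n) : WeylRel n K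
      (FreeAlgebra.ι K (Sum.inl i) * FreeAlgebra.ι K (Sum.inl j))
      (FreeAlgebra.ι K (Sum.inl j) * FreeAlgebra.ι K (Sum.inl i))
  | yy (i j : Fin n) : WeylRel n K
      (FreeAlgebra.ι K (Sum.inr i) * FreeAlgebra.ι K (Sum.inr j))
      (FreeAlgebra.ι K (Sum.inr j) * FreeAlgebra.ι K (Sum.inr i))
  | yx (i j : Fin n) : WeylRel n K
      (FreeAlgebra.ι K (Sum.inr i) * FreeAlgebra.ι K (Sum.inl j))
      (FreeAlgebra.ι K (Sum.inl j) * FreeAlgebra.ι K (Sum.inr i) + if i = j then 1 else 0)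

/-- The `n`-th Weyl algebra `A_n(K)`, by generators and relations. -/
abbrev WeylAlgebra (n : ℕ) (K : Type*) [CommRing K] : Type _ := RingQuot (WeylRel n K)

/-- The field of rational functions `k(t_1, …, t_l)`. -/
abbrev RationalFunctions (l : ℕ) (k : Type*) [Field k] : Type _ :=
  FractionRing (MvPolynomial (Fin l) k)

/-- `A_{n,l}(k) = A_n(k(t_1, …, t_l))`. -/
abbrev WeylAlgebraRat (n l : ℕ) (k : Type*) [Field k] : Type _ :=
  WeylAlgebra n (RationalFunctions l k)

/-- The `k`-division algebra `D` is the Weyl field `𝔻_{n,l}(k)`, i.e. (up to `k`-isomorphism)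
the skew field of fractions of `A_{n,l}(k)`. -/
def IsWeylField (k : Type*) [Field k] (n l : ℕ) (D : Type*) [DivisionRing D] [Algebra k D] :
    Prop :=
  ∃ ι : WeylAlgebraRat n l k →ₐ[k] D, IsSkewFieldOfFractions (ι : WeylAlgebraRat n l k →+* D)

/-! ## Gelfand–Kirillov transcendence degree -/

/-- For a finite dimensional subspace `W` of a `k`-algebra `D`, the Gelfand–Kirillov dimension
of the subalgebra `k[W]`, i.e. `limsup_n log dim (k + W)^n / log n`. -/
def gkDimAdjoin (k : Type*) [Field k] {D : Type*} [Ring D] [Algebra k D] (W : Submodule k D) :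
    EReal :=
  Filter.limsup
    (fun n : ℕ =>
      ((Real.log (Module.finrank k ↥((1 ⊔ W) ^ n)) / Real.log n : ℝ) : EReal)) Filter.atTop

/-- The Gelfand–Kirillov transcendence degree `Tdeg D = sup_V inf_b GKdim k[bV]`; here `V` ranges
over the finite dimensional subspaces and `b` over the regular elements of `D`. -/
def gkTdeg (k : Type*) [Field k] (D : Type*) [Ring D] [Algebra k D] : EReal :=
  ⨆ V : {V : Submodule k D // V.FG}, ⨅ b : D⁰,
    gkDimAdjoin k (V.1.map (LinearMap.mulLeft k (b : D)))

/-- The Gelfand–Kirillov Conjecture holds for the Ore domain `A` over `k`: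
`Frac A ≅ 𝔻_{n,l}(k)`, where `Tdeg Frac A = 2n + l` and `l = tdeg Frac Z(A)`. -/
def GelfandKirillovHolds (k : Type*) [Field k] (A : Type*) [Ring A] [Algebra k A]
    [IsOreDomain A] : Prop :=
  ∃ n l : ℕ,
    gkTdeg k (SkewFrac A) = ((2 * n + l : ℕ) : EReal) ∧
    Algebra.trdeg k (FractionRing (Subalgebra.center k A)) = (l : Cardinal) ∧
    IsWeylField k n l (SkewFrac A)

/-! ## `ℤ`-compatible families -/

/-- A filtration `A_0 ⊆ A_1 ⊆ …` of the ring `R = A_ℤ` with `A_0 = ℤ`, with `A_i = A_1 ^ i`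
a finitely generated free abelian group for `i ≥ 1`, and such that, for all algebraically closed
fields `k`, the groups `k ⊗ A_i` are subspaces of `k ⊗ A_ℤ` (and so filter it). -/
structure IsIntegralFiltration (R : Type v) [Ring R] (F : ℕ → Submodule ℤ R) : Prop where
  mono : Monotone F
  exhaustive : ∀ r : R, ∃ i, r ∈ F i
  zero : F 0 = 1
  pow : ∀ i, 1 ≤ i → F i = F 1 ^ i
  free : ∀ i, 1 ≤ i → Module.Free ℤ (F i)
  finite : ∀ i, 1 ≤ i → Module.Finite ℤ (F i)
  baseChange_injective : ∀ (k : Type u) [Field k] [IsAlgClosed k] (i : ℕ),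
    Function.Injective (LinearMap.lTensor k (F i).subtype)

/-- The family `A_k = k ⊗ A_ℤ` (`k` ranging over all algebraically closed fields, of any
characteristic) attached to the ring `R = A_ℤ` is `ℤ`-compatible.

In `exists_filtration`, the transcendence degree is `dim A_1^k` in the first alternative, and the
dimension `dim A_1^k - 1` of `A_1^k` modulo the scalars in the second one (which is the
normalization for standard filtrations of enveloping algebras and Weyl algebras). -/
structure IsZCompatible (R : Type v) [Ring R] : Prop where
  isOreDomain_int : IsOreDomain R
  isOreDomain : ∀ (k : Type u) [Field k] [IsAlgClosed k], IsOreDomain (k ⊗[ℤ] R)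
  exists_filtration : ∃ F : ℕ → Submodule ℤ R, IsIntegralFiltration.{u} R F ∧
    ((∀ (k : Type u) [Field k] [IsAlgClosed k],
        haveI := isOreDomain k
        gkTdeg k (SkewFrac (k ⊗[ℤ] R)) =
          ((Module.finrank k ((F 1).baseChange k) : ℕ) : EReal)) ∨
      (∀ (k : Type u) [Field k] [IsAlgClosed k],
        haveI := isOreDomain k
        gkTdeg k (SkewFrac (k ⊗[ℤ] R)) + 1 =
          ((Module.finrank k ((F 1).baseChange k) : ℕ) : EReal)))
  center_skewFrac : ∀ (k : Type u) [Field k] [IsAlgClosed k] [CharZero k],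
    haveI := isOreDomain k
    Nonempty (Subalgebra.center k (SkewFrac (k ⊗[ℤ] R)) ≃ₐ[k]
      FractionRing (Subalgebra.center k (k ⊗[ℤ] R)))
  center_polynomial : ∃ (s : ℕ) (x : Fin s → R),
    (∀ (k : Type u) [Field k] [IsAlgClosed k] [CharZero k],
      ∃ hx : ∀ i, (1 : k) ⊗ₜ[ℤ] x i ∈ Subalgebra.center k (k ⊗[ℤ] R),
        Function.Bijective (MvPolynomial.aeval
          (fun i => (⟨(1 : k) ⊗ₜ[ℤ] x i, hx i⟩ : Subalgebra.center k (k ⊗[ℤ] R))) :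
            MvPolynomial (Fin s) k →ₐ[k] Subalgebra.center k (k ⊗[ℤ] R))) ∧
    (∀ (p : ℕ) [Fact p.Prime] (k : Type u) [Field k] [IsAlgClosed k] [CharP k p] (i : Fin s),
      (1 : k) ⊗ₜ[ℤ] x i ∈ Subalgebra.center k (k ⊗[ℤ] R))

/-! ## The variety and the Weyl generators -/

/-- The locally closed subset of `k^N` cut out by integer polynomials: the common zeros of all
`f ∈ F` at which some `g ∈ G` does not vanish. -/
def integralLocallyClosed {N : ℕ} (F G : Finset (MvPolynomial (Fin N) ℤ)) (k : Type*) [Field k] :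
    Set (Fin N → k) :=
  {z | (∀ f ∈ F, MvPolynomial.aeval z f = 0) ∧ ∃ g ∈ G, MvPolynomial.aeval z g ≠ 0}

/-- Specialization of an element of `ℤ[T_1, …, T_N] ⊗ A_ℤ` at a point `z` of `k^N`; the result is
an element of `A_k = k ⊗ A_ℤ`. -/
def specialize (R : Type v) [Ring R] {N : ℕ} {k : Type u} [Field k] (z : Fin N → k) :
    MvPolynomial (Fin N) ℤ ⊗[ℤ] R →ₐ[ℤ] k ⊗[ℤ] R :=
  Algebra.TensorProduct.map (MvPolynomial.aeval z) (AlgHom.id ℤ R)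

/-- Elements `w_1, …, w_m, w_{m+1}, …, w_{2m}` of `Frac A` that satisfy the Weyl relations and
generate the skew field `Frac A` over its centre: each element of `Frac A` has the form `q⁻¹ p`,
where `p` and `q` are polynomials in the `w`'s with central coefficients. -/
structure IsWeylGenerators (k : Type*) [Field k] (A : Type*) [Ring A] [Algebra k A]
    [IsOreDomain A] (m : ℕ) (w : Fin m ⊕ Fin m → SkewFrac A) : Prop where
  comm_left : ∀ i j, w (Sum.inl i) * w (Sum.inl j) = w (Sum.inl j) * w (Sum.inl i)
  comm_right : ∀ i j, w (Sum.inr i) * w (Sum.inr j) = w (Sum.inr j) * w (Sum.inr i)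
  comm_mixed : ∀ i j, w (Sum.inl i) * w (Sum.inr j) - w (Sum.inr j) * w (Sum.inl i) =
    if i = j then 1 else 0
  exists_frac : ∀ d : SkewFrac A,
    ∃ p ∈ Algebra.adjoin k (Set.range w ∪ (Subalgebra.center k (SkewFrac A) : Set (SkewFrac A))),
    ∃ q ∈ Algebra.adjoin k (Set.range w ∪ (Subalgebra.center k (SkewFrac A) : Set (SkewFrac A))),
      q ≠ 0 ∧ q * d = p

end

/-! If the conjecture fails over every field, the empty variety works. Otherwise fix one field `k₀`
over which it holds. The isomorphism with a Weyl field is captured by finite data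
(`IsWeylPresentation`): a Weyl tuple `w`, elements `t` commuting with finitely many generators of
`A_ℤ`, expressions of these generators as fractions in `w` and `t`, and equations making the central
generators `x_i` algebraic over `t`. Such data involve only finitely many sums, products and
nonvanishing conditions in `k₀`, hence a finite set `s ⊆ k₀`. The variety consists of the maps `s →
k` that respect the sums, the products and the unit inside `s` and kill no nonzero element. It is
defined over `ℤ`, and by the Nullstellensatz (`exists_mem_partialHoms`) it has points over every
`k`. So the conjecture holds over all fields or over none.

To avoid bookkeeping, all set maps `k₀ → k` are considered along the filter `generic`, generated by
the sets of maps respecting a finite part of `k₀`. `A_{k₀}` maps to the reduced product of the skew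
fields `Frac A_k`. Freeness of the filtration makes images of nonzero elements invertible
(`isUnit_toReduced`), so the map extends to `Frac A_{k₀}`. Representatives in the product give a
spreading `σ` under which every identity holds eventually.

Conversely, a presentation over `k` yields a Weyl field (`IsWeylPresentation.isWeylField`). The `t`
are central because they commute with generators, and independent because equally many independent
`x_i` are algebraic over them. The Weyl algebra over `k(t)` embeds since it is simple in
characteristic zero (`injective_of_adjoin_eq_top`), it is Ore since it grows polynomially
(`left_ore`), and its fractions contain all generators. The transcendence degree is the same over
all fields by the filtration axiom. -/

noncomputable section

/-! ## Weyl tuples -/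

/-- A tuple `x_1, …, x_n, y_1, …, y_n` of elements of a ring that satisfies the relations of the
Weyl algebra. -/
structure IsWeylTuple {A : Type*} [Ring A] {n : ℕ} (g : Fin n ⊕ Fin n → A) : Prop where
  xx : ∀ i j, g (Sum.inl i) * g (Sum.inl j) = g (Sum.inl j) * g (Sum.inl i)
  yy : ∀ i j, g (Sum.inr i) * g (Sum.inr j) = g (Sum.inr j) * g (Sum.inr i)
  yx : ∀ i j, g (Sum.inr i) * g (Sum.inl j) = g (Sum.inl j) * g (Sum.inr i) + if i = j then 1 else 0

/-! ### The degree filtration of a tuple -/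

section Filtration

variable (K : Type*) [Field K] {A : Type*} [Ring A] [Algebra K A] {n : ℕ}
  (g : Fin n ⊕ Fin n → A)

/-- The span of `1` and of the elements of a tuple. -/
def generatorSpan : Submodule K A := Submodule.span K (insert 1 (Set.range g))

variable {K g}

lemma one_mem_generatorSpan : (1 : A) ∈ generatorSpan K g :=
  Submodule.subset_span (Set.mem_insert _ _)

lemma mem_generatorSpan (i : Fin n ⊕ Fin n) : g i ∈ generatorSpan K g :=
  Submodule.subset_span (Set.mem_insert_of_mem _ ⟨i, rfl⟩)

lemma one_le_generatorSpan : (1 : Submodule K A) ≤ generatorSpan K g := by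
  rw [Submodule.one_le]
  exact one_mem_generatorSpan

lemma generatorSpan_pow_mono {r s : ℕ} (h : r ≤ s) :
    generatorSpan K g ^ r ≤ generatorSpan K g ^ s :=
  pow_le_pow_right₀ one_le_generatorSpan h

lemma one_mem_generatorSpan_pow (r : ℕ) : (1 : A) ∈ generatorSpan K g ^ r :=
  Submodule.one_le.mp (one_le_pow_of_one_le' one_le_generatorSpan r)

lemma mul_mem_generatorSpan_pow {r s : ℕ} {a b : A} (ha : a ∈ generatorSpan K g ^ r)
    (hb : b ∈ generatorSpan K g ^ s) : a * b ∈ generatorSpan K g ^ (r + s) := by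
  rw [pow_add]
  exact Submodule.mul_mem_mul ha hb

lemma generator_mul_mem {r : ℕ} (i : Fin n ⊕ Fin n) {a : A} (ha : a ∈ generatorSpan K g ^ r) :
    g i * a ∈ generatorSpan K g ^ (r + 1) := by
  rw [pow_succ']
  exact Submodule.mul_mem_mul (mem_generatorSpan i) ha

/-- An additive predicate on the `(r+1)`-st piece of the filtration holds if it holds for the
products of a generator (or `1`) with an element of the `r`-th piece. -/
lemma generatorSpan_pow_succ_induction {r : ℕ} {P : A → Prop} (hadd : ∀ a b, P a → P b → P (a + b))
    (hone : ∀ a ∈ generatorSpan K g ^ r, P a)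
    (hgen : ∀ i, ∀ a ∈ generatorSpan K g ^ r, P (g i * a)) {a : A}
    (ha : a ∈ generatorSpan K g ^ (r + 1)) : P a := by
  rw [pow_succ'] at ha
  refine Submodule.mul_induction_on ha ?_ hadd
  intro u hu
  induction hu using Submodule.span_induction with
  | mem x hx =>
    rcases hx with rfl | ⟨i, rfl⟩
    · intro v hv
      rw [one_mul]
      exact hone v hv
    · exact hgen i
  | zero =>
    intro v _
    rw [zero_mul]
    exact hone 0 (Submodule.zero_mem _)
  | add x y _ _ hx hy =>
    intro v hv
    rw [add_mul]
    exact hadd _ _ (hx v hv) (hy v hv)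
  | smul c x _ hx =>
    intro v hv
    rw [smul_mul_assoc, ← mul_smul_comm]
    exact hx _ (Submodule.smul_mem _ c hv)

lemma exists_mem_generatorSpan_pow (htop : Algebra.adjoin K (Set.range g) = ⊤) (a : A) :
    ∃ r, a ∈ generatorSpan K g ^ r := by
  have ha : a ∈ Algebra.adjoin K (Set.range g) := htop ▸ Algebra.mem_top
  induction ha using Algebra.adjoin_induction with
  | mem x hx =>
    obtain ⟨i, rfl⟩ := hx
    exact ⟨1, by rw [pow_one]; exact mem_generatorSpan i⟩
  | algebraMap c => exact ⟨0, by rw [pow_zero]; exact Submodule.algebraMap_mem c⟩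
  | add x y _ _ hx hy =>
    obtain ⟨r, hr⟩ := hx
    obtain ⟨s, hs⟩ := hy
    exact ⟨max r s, add_mem (generatorSpan_pow_mono (le_max_left _ _) hr)
      (generatorSpan_pow_mono (le_max_right _ _) hs)⟩
  | mul x y _ _ hx hy =>
    obtain ⟨r, hr⟩ := hx
    obtain ⟨s, hs⟩ := hy
    exact ⟨r + s, mul_mem_generatorSpan_pow hr hs⟩

end Filtration

/-! ### Commutators, the Euler operator and simplicity -/

namespace IsWeylTuple

variable {K : Type*} [Field K] {A : Type*} [Ring A] [Algebra K A] {n : ℕ}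
  {g : Fin n ⊕ Fin n → A}

lemma commutator_eq_algebraMap (hg : IsWeylTuple g) (i j : Fin n ⊕ Fin n) :
    ∃ c : K, g i * g j - g j * g i = algebraMap K A c := by
  rcases i with i | i <;> rcases j with j | j
  · exact ⟨0, by rw [hg.xx i j]; simp⟩
  · refine ⟨if j = i then -1 else 0, ?_⟩
    rw [hg.yx j i]
    split_ifs <;> simp
  · refine ⟨if i = j then 1 else 0, ?_⟩
    rw [hg.yx i j]
    split_ifs <;> simp
  · exact ⟨0, by rw [hg.yy i j]; simp⟩

lemma commutator_eq_zero (i : Fin n ⊕ Fin n) {a : A} (ha : a ∈ generatorSpan K g ^ 0) :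
    g i * a - a * g i = 0 := by
  rw [pow_zero, Submodule.mem_one] at ha
  obtain ⟨c, rfl⟩ := ha
  rw [Algebra.commutes, sub_self]

/-- Commutators of generators are scalars, so the derivation `[g i, ·]` removes one letter from a
product. -/
lemma commutator_mem (hg : IsWeylTuple g) (i : Fin n ⊕ Fin n) (r : ℕ) {a : A}
    (ha : a ∈ generatorSpan K g ^ (r + 1)) : g i * a - a * g i ∈ generatorSpan K g ^ r := by
  induction r generalizing a with
  | zero =>
    refine generatorSpan_pow_succ_induction (P := fun a => g i * a - a * g i ∈ _) (fun a b ha hb => ?_)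
      (fun a ha => ?_) (fun j a ha => ?_) ha
    · rw [mul_add, add_mul, add_sub_add_comm]; exact add_mem ha hb
    · rw [commutator_eq_zero i ha]; exact zero_mem _
    · obtain ⟨c, hc⟩ := hg.commutator_eq_algebraMap (K := K) i j
      have h := commutator_eq_zero i ha
      have : g i * (g j * a) - g j * a * g i = (g i * g j - g j * g i) * a
          + g j * (g i * a - a * g i) := by noncomm_ring
      rw [this, h, hc, mul_zero, add_zero, ← Algebra.smul_def]
      exact Submodule.smul_mem _ c ha
  | succ r ih =>
    refine generatorSpan_pow_succ_induction (P := fun a => g i * a - a * g i ∈ _) (fun a b ha hb => ?_)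
      (fun a ha => ?_) (fun j a ha => ?_) ha
    · rw [mul_add, add_mul, add_sub_add_comm]; exact add_mem ha hb
    · exact generatorSpan_pow_mono (Nat.le_succ r) (ih ha)
    · obtain ⟨c, hc⟩ := hg.commutator_eq_algebraMap (K := K) i j
      have : g i * (g j * a) - g j * a * g i = (g i * g j - g j * g i) * a
          + g j * (g i * a - a * g i) := by noncomm_ring
      rw [this, hc, ← Algebra.smul_def]
      exact add_mem (Submodule.smul_mem _ c ha) (generator_mul_mem j (ih ha))

/-- The normally ordered Euler operator, which multiplies a normally ordered monomial by its
degree. -/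
def euler (g : Fin n ⊕ Fin n → A) (a : A) : A :=
  ∑ i, (g (Sum.inl i) * (g (Sum.inr i) * a - a * g (Sum.inr i)) -
    (g (Sum.inl i) * a - a * g (Sum.inl i)) * g (Sum.inr i))

lemma euler_add (a b : A) : euler g (a + b) = euler g a + euler g b := by
  simp only [euler, ← Finset.sum_add_distrib]
  refine Finset.sum_congr rfl fun i _ => ?_
  noncomm_ring

lemma euler_eq_zero {a : A} (h : ∀ i, g i * a - a * g i = 0) : euler g a = 0 := by
  simp [euler, h]

/-- `[y_i, ·]` differentiates by `x_i` and `-[x_i, ·]` by `y_i`. Since `euler` puts `x_i` on the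
left and `y_i` on the right, normal order is kept, and a factor `x_j` on the left raises the degree
by exactly one. -/
lemma euler_inl_mul (hg : IsWeylTuple g) (j : Fin n) (a : A) :
    euler g (g (Sum.inl j) * a) = g (Sum.inl j) * euler g a + g (Sum.inl j) * a := by
  have key : ∀ i, g (Sum.inl i) * (g (Sum.inr i) * (g (Sum.inl j) * a)
      - g (Sum.inl j) * a * g (Sum.inr i)) -
      (g (Sum.inl i) * (g (Sum.inl j) * a) - g (Sum.inl j) * a * g (Sum.inl i)) * g (Sum.inr i) =
      g (Sum.inl j) * (g (Sum.inl i) * (g (Sum.inr i) * a - a * g (Sum.inr i)) -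
        (g (Sum.inl i) * a - a * g (Sum.inl i)) * g (Sum.inr i)) +
      (if i = j then g (Sum.inl i) * a else 0) := by
    intro i
    have h1 := hg.xx i j
    have h2 := hg.yx i j
    have e1 : g (Sum.inr i) * (g (Sum.inl j) * a) = g (Sum.inl j) * (g (Sum.inr i) * a)
        + if i = j then a else 0 := by
      rw [← mul_assoc, h2, add_mul, mul_assoc]
      split_ifs <;> simp
    have e2 : ∀ b, g (Sum.inl i) * (g (Sum.inl j) * b) = g (Sum.inl j) * (g (Sum.inl i) * b) := by
      intro b
      rw [← mul_assoc, h1, mul_assoc]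
    rw [e1]
    simp only [mul_assoc, mul_sub, sub_mul, mul_add, e2, mul_ite, mul_zero]
    split_ifs <;> abel
  simp only [euler, key, Finset.sum_add_distrib, ← Finset.mul_sum]
  simp

/-- A factor `y_j` on the left is out of normal order. Moving it to the right and back costs two
commutators, which have lower degree. -/
lemma euler_inr_mul (hg : IsWeylTuple g) (j : Fin n) (a : A) :
    euler g (g (Sum.inr j) * a) = g (Sum.inr j) * euler g a + g (Sum.inr j) * a
      - (g (Sum.inr j) * a - a * g (Sum.inr j)) - (g (Sum.inr j) * a - a * g (Sum.inr j)) := by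
  have key : ∀ i, g (Sum.inl i) * (g (Sum.inr i) * (g (Sum.inr j) * a)
      - g (Sum.inr j) * a * g (Sum.inr i)) -
      (g (Sum.inl i) * (g (Sum.inr j) * a) - g (Sum.inr j) * a * g (Sum.inl i)) * g (Sum.inr i) =
      g (Sum.inr j) * (g (Sum.inl i) * (g (Sum.inr i) * a - a * g (Sum.inr i)) -
        (g (Sum.inl i) * a - a * g (Sum.inl i)) * g (Sum.inr i)) +
      (if j = i then a * g (Sum.inr i) - (g (Sum.inr i) * a - a * g (Sum.inr i)) else 0) := by
    intro i
    have h1 := hg.yy i j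
    have h2 := hg.yx j i
    have e1 : ∀ b, g (Sum.inl i) * (g (Sum.inr j) * b) = g (Sum.inr j) * (g (Sum.inl i) * b)
        - if j = i then b else 0 := by
      intro b
      rw [← mul_assoc, ← mul_assoc, h2, add_mul]
      split_ifs <;> simp
    have e2 : ∀ b, g (Sum.inr i) * (g (Sum.inr j) * b) = g (Sum.inr j) * (g (Sum.inr i) * b) := by
      intro b
      rw [← mul_assoc, h1, mul_assoc]
    simp only [mul_assoc, mul_sub, sub_mul, e1, e2]
    split_ifs
    · abel
    · simp only [zero_mul, sub_zero]
      abel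
  simp only [euler, key, Finset.sum_add_distrib, ← Finset.mul_sum]
  simp
  abel

/-- The Euler operator acts on leading terms by their degree; this replaces a monomial basis in the
proof of simplicity. -/
lemma euler_sub_mem (hg : IsWeylTuple g) (r : ℕ) {a : A} (ha : a ∈ generatorSpan K g ^ (r + 1)) :
    euler g a - ((r + 1 : ℕ) : K) • a ∈ generatorSpan K g ^ r := by
  induction r generalizing a with
  | zero =>
    refine generatorSpan_pow_succ_induction (P := fun a => euler g a - _ • a ∈ _) (fun a b ha hb => ?_)
      (fun a ha => ?_) (fun j a ha => ?_) ha
    · rw [euler_add, smul_add, add_sub_add_comm]; exact add_mem ha hb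
    · rw [euler_eq_zero fun i => commutator_eq_zero i ha, zero_sub]
      exact neg_mem (Submodule.smul_mem _ _ ha)
    · have h0 := euler_eq_zero fun i => commutator_eq_zero i ha
      rcases j with j | j
      · rw [hg.euler_inl_mul, h0]
        simp
      · rw [hg.euler_inr_mul, h0, commutator_eq_zero _ ha]
        simp
  | succ r ih =>
    refine generatorSpan_pow_succ_induction (P := fun a => euler g a - _ • a ∈ _) (fun a b ha hb => ?_)
      (fun a ha => ?_) (fun j a ha => ?_) ha
    · rw [euler_add, smul_add, add_sub_add_comm]; exact add_mem ha hb
    · have h1 := generatorSpan_pow_mono (Nat.le_succ r) (ih ha)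
      have h2 := Submodule.sub_mem _ h1 ha
      convert h2 using 1
      push_cast
      module
    · have h1 := generator_mul_mem j (ih ha)
      rcases j with j | j
      · rw [hg.euler_inl_mul]
        convert h1 using 1
        rw [mul_sub, mul_smul_comm]
        push_cast
        module
      · rw [hg.euler_inr_mul]
        have h3 := generatorSpan_pow_mono (Nat.le_succ r) (hg.commutator_mem (Sum.inr j) r ha)
        convert Submodule.sub_mem _ (Submodule.sub_mem _ h1 h3) h3 using 1
        rw [mul_sub, mul_smul_comm]
        push_cast
        module

/-- In characteristic zero, algebra homomorphisms out of an algebra that is generated by a Weyl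
tuple are injective. -/
theorem injective_of_adjoin_eq_top [CharZero K] (hg : IsWeylTuple g)
    (htop : Algebra.adjoin K (Set.range g) = ⊤) {D : Type*} [Ring D] [Nontrivial D] [Algebra K D]
    (f : A →ₐ[K] D) : Function.Injective f := by
  rw [injective_iff_map_eq_zero]
  intro a hfa
  obtain ⟨r, ha⟩ := exists_mem_generatorSpan_pow htop a
  induction r generalizing a with
  | zero =>
    rw [pow_zero, Submodule.mem_one] at ha
    obtain ⟨c, rfl⟩ := ha
    rw [AlgHom.commutes, FaithfulSMul.algebraMap_eq_zero_iff] at hfa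
    rw [hfa, map_zero]
  | succ r ih =>
    -- The commutators also lie in the kernel and have lower degree, so they vanish by induction.
    -- Then `euler g a = 0` forces `(r + 1) • a`, hence in characteristic zero `a` itself, into
    -- lower degree.
    have hcomm : ∀ i, g i * a - a * g i = 0 := fun i =>
      ih _ (by simp [hfa]) (hg.commutator_mem i r ha)
    have h := hg.euler_sub_mem r ha
    rw [euler_eq_zero hcomm, zero_sub, neg_mem_iff] at h
    refine ih a hfa ?_
    have h0 : ((r + 1 : ℕ) : K) ≠ 0 := Nat.cast_ne_zero.mpr (Nat.succ_ne_zero r)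
    exact (Submodule.smul_mem_iff _ h0).mp h

/-! ### Growth and the Ore condition -/

lemma list_prod_mem (L : List (Fin n ⊕ Fin n)) {r : ℕ} (hL : L.length ≤ r) :
    (L.map g).prod ∈ generatorSpan K g ^ r := by
  refine generatorSpan_pow_mono hL ?_
  clear hL
  induction L with
  | nil => exact one_mem_generatorSpan_pow 0
  | cons i L ih =>
    rw [List.map_cons, List.prod_cons, List.length_cons]
    exact generator_mul_mem i ih

/-- Exchanging two adjacent letters changes a word by a scalar multiple of a word that is two
letters shorter. -/
lemma list_prod_sub_mem_of_perm (hg : IsWeylTuple g) {L₁ L₂ : List (Fin n ⊕ Fin n)}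
    (h : L₁.Perm L₂) (r : ℕ) (hr : L₁.length ≤ r + 1) :
    (L₁.map g).prod - (L₂.map g).prod ∈ generatorSpan K g ^ r := by
  induction h generalizing r with
  | nil => simp
  | cons i h ih =>
    rename_i L₁ L₂
    rw [List.length_cons] at hr
    rcases r with _ | r
    · have h1 : L₁ = [] := List.eq_nil_of_length_eq_zero (by omega)
      subst h1
      rw [List.nil_perm.mp h]
      simp
    · simp only [List.map_cons, List.prod_cons, ← mul_sub]
      exact generator_mul_mem i (ih r (by omega))
  | swap i j L =>
    obtain ⟨c, hc⟩ := hg.commutator_eq_algebraMap (K := K) j i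
    simp only [List.map_cons, List.prod_cons, ← mul_assoc, ← sub_mul]
    rw [hc, ← Algebra.smul_def]
    simp only [List.length_cons] at hr
    exact Submodule.smul_mem _ c (list_prod_mem L (by omega))
  | trans h₁ h₂ ih₁ ih₂ =>
    rw [← sub_add_sub_cancel]
    exact add_mem (ih₁ r hr) (ih₂ r (h₁.length_eq ▸ hr))

lemma mem_span_list_prod {r : ℕ} {a : A} (ha : a ∈ generatorSpan K g ^ r) :
    a ∈ Submodule.span K {b | ∃ L : List (Fin n ⊕ Fin n), L.length ≤ r ∧ (L.map g).prod = b} := by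
  induction r generalizing a with
  | zero =>
    rw [pow_zero, Submodule.mem_one] at ha
    obtain ⟨c, rfl⟩ := ha
    rw [Algebra.algebraMap_eq_smul_one]
    exact Submodule.smul_mem _ c (Submodule.subset_span ⟨[], by simp, by simp⟩)
  | succ r ih =>
    refine generatorSpan_pow_succ_induction (P := fun a => a ∈ _) (fun a b ha hb => ?_)
      (fun a ha => ?_) (fun i a ha => ?_) ha
    · exact add_mem ha hb
    · refine Submodule.span_mono ?_ (ih ha)
      rintro _ ⟨L, hL, rfl⟩
      exact ⟨L, hL.trans (Nat.le_succ r), rfl⟩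
    · have h := Submodule.mem_map_of_mem (f := LinearMap.mulLeft K (g i)) (ih ha)
      rw [Submodule.map_span] at h
      refine Submodule.span_mono ?_ h
      rintro _ ⟨_, ⟨L, hL, rfl⟩, rfl⟩
      exact ⟨i :: L, by simpa using hL, by simp⟩

/-- The product of the elements of a tuple with the multiplicities `e`, in some order. -/
def word (g : Fin n ⊕ Fin n → A) (e : Fin n ⊕ Fin n →₀ ℕ) : A :=
  ((Finsupp.toMultiset e).toList.map g).prod

/-- Up to lower degree, a word depends only on its multiplicities, so one word per exponent vector
suffices. Bounding each exponent separately, not the total degree, is crude but makes the count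
immediate. -/
lemma generatorSpan_pow_le (hg : IsWeylTuple g) (r : ℕ) :
    generatorSpan K g ^ r ≤ Submodule.span K
      (Set.range fun e : Fin n ⊕ Fin n → Fin (r + 1) =>
        word g (Finsupp.equivFunOnFinite.symm fun i => (e i : ℕ))) := by
  suffices H : generatorSpan K g ^ r ≤ Submodule.span K
      {a | ∃ e : Fin n ⊕ Fin n →₀ ℕ, (∀ i, e i < r + 1) ∧ word g e = a} by
    refine H.trans (Submodule.span_mono ?_)
    rintro _ ⟨e, he, rfl⟩
    exact ⟨fun i => ⟨e i, he i⟩, congrArg _ (by ext; simp)⟩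
  have step : ∀ (r : ℕ) (L : List (Fin n ⊕ Fin n)), L.length ≤ r →
      word g (Multiset.toFinsupp (L : Multiset (Fin n ⊕ Fin n))) ∈
        {a | ∃ e : Fin n ⊕ Fin n →₀ ℕ, (∀ i, e i < r + 1) ∧ word g e = a} := by
    intro r L hL
    refine ⟨_, fun i => ?_, rfl⟩
    rw [Multiset.toFinsupp_apply]
    exact Nat.lt_succ_of_le ((Multiset.count_le_card i (L : Multiset (Fin n ⊕ Fin n))).trans hL)
  have hperm : ∀ L : List (Fin n ⊕ Fin n),
      L.Perm (Finsupp.toMultiset (Multiset.toFinsupp (L : Multiset (Fin n ⊕ Fin n)))).toList := by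
    intro L
    rw [← Multiset.coe_eq_coe]
    simp
  induction r with
  | zero =>
    intro a ha
    refine Submodule.span_mono ?_ (mem_span_list_prod ha)
    rintro _ ⟨L, hL, rfl⟩
    have : L = [] := List.eq_nil_of_length_eq_zero (by omega)
    subst this
    convert step 0 [] le_rfl using 1
    simp [word]
  | succ r ih =>
    intro a ha
    refine Submodule.span_le.mpr ?_ (mem_span_list_prod ha)
    rintro _ ⟨L, hL, rfl⟩
    have h1 := ih (hg.list_prod_sub_mem_of_perm (K := K) (hperm L) r hL)
    have h2 := Submodule.subset_span (R := K) (step (r + 1) L hL)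
    rw [SetLike.mem_coe, ← sub_add_cancel ((L.map g).prod)
      (word g (Multiset.toFinsupp (L : Multiset (Fin n ⊕ Fin n))))]
    refine add_mem (Submodule.span_mono ?_ h1) h2
    rintro _ ⟨e, he, rfl⟩
    exact ⟨e, fun i => (he i).trans (Nat.lt_succ_self _), rfl⟩

lemma finite_generatorSpan_pow (r : ℕ) : Module.Finite K ↥(generatorSpan K g ^ r) := by
  have : (generatorSpan K g).FG := Submodule.fg_span (Set.Finite.insert _ (Set.finite_range g))
  exact Module.Finite.iff_fg.mpr (this.pow r)

lemma finrank_generatorSpan_pow_le (hg : IsWeylTuple g) (r : ℕ) :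
    Module.finrank K ↥(generatorSpan K g ^ r) ≤ (r + 1) ^ (2 * n) := by
  classical
  have := Module.Finite.span_of_finite K (Set.finite_range
    fun e : Fin n ⊕ Fin n → Fin (r + 1) =>
        word g (Finsupp.equivFunOnFinite.symm fun i => (e i : ℕ)))
  refine (Submodule.finrank_mono (hg.generatorSpan_pow_le (K := K) r)).trans ?_
  refine (finrank_range_le_card _).trans (le_of_eq ?_)
  simp [two_mul]

lemma exists_pow_lt_two_pow (d N : ℕ) : ∃ j : ℕ, (j * d + 1) ^ N < 2 ^ j := by
  have h := tendsto_pow_const_div_const_pow_of_one_lt N (r := (2 : ℝ)) one_lt_two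
  have h2 : Filter.Tendsto (fun j : ℕ => ((d + 1 : ℝ) ^ N) * ((j : ℝ) ^ N / 2 ^ j)) Filter.atTop
      (nhds 0) := by simpa using h.const_mul ((d + 1 : ℝ) ^ N)
  obtain ⟨j, hj, hj1⟩ :=
    ((h2.eventually (gt_mem_nhds one_pos)).and (Filter.eventually_ge_atTop 1)).exists
  refine ⟨j, ?_⟩
  rw [← mul_div_assoc, div_lt_one (by positivity), ← mul_pow] at hj
  have h3 : (((j * d + 1) ^ N : ℕ) : ℝ) < ((2 ^ j : ℕ) : ℝ) := by
    push_cast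
    refine lt_of_le_of_lt (pow_le_pow_left₀ (by positivity) ?_ N) hj
    have : (1 : ℝ) ≤ j := by exact_mod_cast hj1
    nlinarith
  exact_mod_cast h3

/-- A domain that is generated by a Weyl tuple satisfies the left Ore condition. -/
theorem left_ore [IsDomain A] (hg : IsWeylTuple g) (htop : Algebra.adjoin K (Set.range g) = ⊤)
    (a b : A) (hb : b ≠ 0) : ∃ c d : A, d ≠ 0 ∧ d * a = c * b := by
  by_contra! hcon
  have ha : a ≠ 0 := by
    rintro rfl
    exact hcon 0 1 one_ne_zero (by simp)
  obtain ⟨r₁, h₁⟩ := exists_mem_generatorSpan_pow htop a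
  obtain ⟨r₂, h₂⟩ := exists_mem_generatorSpan_pow htop b
  set d := max r₁ r₂
  replace h₁ := generatorSpan_pow_mono (le_max_left r₁ r₂) h₁
  replace h₂ := generatorSpan_pow_mono (le_max_right r₁ r₂) h₂
  have hfin := finite_generatorSpan_pow (K := K) (g := g)
  -- Without a common left multiple, `(u, v) ↦ u * a - v * b` is injective. So the dimension doubles
  -- every `d` degrees, against the polynomial bound.
  have hstep : ∀ r, 2 * Module.finrank K ↥(generatorSpan K g ^ r) ≤
      Module.finrank K ↥(generatorSpan K g ^ (r + d)) := by
    intro r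
    let f : (↥(generatorSpan K g ^ r) × ↥(generatorSpan K g ^ r)) →ₗ[K]
        ↥(generatorSpan K g ^ (r + d)) :=
      LinearMap.codRestrict _
        (((LinearMap.mulRight K a).comp (Submodule.subtype _)).coprod
          (-((LinearMap.mulRight K b).comp (Submodule.subtype _))))
        (fun p => by
          simp only [LinearMap.coprod_apply, LinearMap.neg_apply, LinearMap.comp_apply,
            Submodule.subtype_apply, LinearMap.mulRight_apply]
          exact add_mem (mul_mem_generatorSpan_pow p.1.2 h₁)
            (neg_mem (mul_mem_generatorSpan_pow p.2.2 h₂)))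
    have hf : Function.Injective f := by
      rw [← LinearMap.ker_eq_bot, LinearMap.ker_eq_bot']
      rintro ⟨⟨u, hu⟩, ⟨v, hv⟩⟩ h
      have h' : u * a + -(v * b) = 0 := congrArg Subtype.val h
      rw [← sub_eq_add_neg, sub_eq_zero] at h'
      have hu0 : u = 0 := by
        by_contra hu0
        exact hcon v u hu0 h'
      subst hu0
      have hv0 : v = 0 := by
        rw [zero_mul] at h'
        exact (mul_eq_zero.mp h'.symm).resolve_right hb
      subst hv0
      rfl
    have := LinearMap.finrank_le_finrank_of_injective hf
    rwa [Module.finrank_prod, ← two_mul] at this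
  have hpow : ∀ j, 2 ^ j ≤ Module.finrank K ↥(generatorSpan K g ^ (j * d)) := by
    intro j
    induction j with
    | zero =>
      rw [pow_zero, Nat.one_le_iff_ne_zero, ← Nat.pos_iff_ne_zero, Module.finrank_pos_iff_exists_ne_zero]
      exact ⟨⟨1, one_mem_generatorSpan_pow _⟩, fun h => one_ne_zero (congrArg Subtype.val h)⟩
    | succ j ih =>
      rw [pow_succ', add_mul, one_mul]
      exact (Nat.mul_le_mul_left 2 ih).trans (hstep _)
  obtain ⟨j, hj⟩ := exists_pow_lt_two_pow d (2 * n)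
  exact absurd ((hpow j).trans (hg.finrank_generatorSpan_pow_le _)) (not_le.mpr hj)

end IsWeylTuple

/-! ## Fractions of an Ore subring of a division ring -/

/-- The left fractions of a left Ore subring of a division ring. -/
def Subring.leftFractions {D : Type*} [DivisionRing D] (S : Subring D)
    (hS : ∀ a ∈ S, ∀ b ∈ S, b ≠ 0 → ∃ c ∈ S, ∃ d ∈ S, d ≠ 0 ∧ d * a = c * b) : Subfield D where
  carrier := {x | ∃ p ∈ S, ∃ q ∈ S, q ≠ 0 ∧ q * x = p}
  one_mem' := ⟨1, S.one_mem, 1, S.one_mem, one_ne_zero, one_mul 1⟩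
  zero_mem' := ⟨0, S.zero_mem, 1, S.one_mem, one_ne_zero, mul_zero 1⟩
  neg_mem' := by
    rintro x ⟨p, hp, q, hq, hq0, h⟩
    exact ⟨-p, S.neg_mem hp, q, hq, hq0, by rw [mul_neg, h]⟩
  mul_mem' := by
    rintro x y ⟨p, hp, q, hq, hq0, rfl⟩ ⟨p₁, hp₁, q₁, hq₁, hq₁0, rfl⟩
    obtain ⟨c, hc, d, hd, hd0, h⟩ := hS _ hp _ hq₁ hq₁0
    refine ⟨c * (q₁ * y), S.mul_mem hc hp₁, d * q, S.mul_mem hd hq, mul_ne_zero hd0 hq0, ?_⟩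
    rw [← mul_assoc c, ← h]
    simp only [mul_assoc]
  add_mem' := by
    rintro x y ⟨p, hp, q, hq, hq0, rfl⟩ ⟨p₁, hp₁, q₁, hq₁, hq₁0, rfl⟩
    obtain ⟨c, hc, d, hd, hd0, h⟩ := hS _ hq _ hq₁ hq₁0
    refine ⟨d * (q * x) + c * (q₁ * y), S.add_mem (S.mul_mem hd hp) (S.mul_mem hc hp₁), d * q,
      S.mul_mem hd hq, mul_ne_zero hd0 hq0, ?_⟩
    rw [← mul_assoc c, ← h, ← mul_assoc, mul_add]
  inv_mem' := by
    rintro x ⟨p, hp, q, hq, hq0, rfl⟩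
    by_cases hx : x = 0
    · subst hx
      exact ⟨0, S.zero_mem, 1, S.one_mem, one_ne_zero, by simp⟩
    · exact ⟨q, hq, q * x, hp, mul_ne_zero hq0 hx, by rw [mul_assoc, mul_inv_cancel₀ hx, mul_one]⟩

/-! ## The skew field of fractions of an Ore domain -/

namespace SkewFrac

variable {A : Type*} [Ring A] [IsOreDomain A]

lemma isUnit_of {a : A} (ha : a ≠ 0) : IsUnit (SkewFrac.of A a) :=
  OreLocalization.numerator_isUnit (⟨a, mem_nonZeroDivisors_of_ne_zero ha⟩ : A⁰)

lemma of_injective : Function.Injective (SkewFrac.of A) := by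
  intro a b h
  by_contra hab
  have h1 := isUnit_of (sub_ne_zero.mpr hab)
  rw [map_sub, h, sub_self] at h1
  exact not_isUnit_zero h1

lemma of_ne_zero {a : A} (ha : a ≠ 0) : SkewFrac.of A a ≠ 0 :=
  (map_ne_zero_iff _ of_injective).mpr ha

lemma exists_eq_inv_mul (d : SkewFrac A) :
    ∃ a b : A, b ≠ 0 ∧ d = (SkewFrac.of A b)⁻¹ * SkewFrac.of A a := by
  induction d using OreLocalization.ind with
  | _ a b =>
    have hb := nonZeroDivisors.coe_ne_zero b
    refine ⟨a, b, hb, ?_⟩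
    rw [eq_inv_mul_iff_mul_eq₀ (of_ne_zero hb)]
    change (b : A) /ₒ (1 : A⁰) * (a /ₒ b) = a /ₒ (1 : A⁰)
    exact OreLocalization.mul_cancel

/-- A ring homomorphism that sends the nonzero elements of an Ore domain to units extends to the
skew field of fractions. -/
lemma exists_lift {T : Type*} [Ring T] (f : A →+* T) (hf : ∀ a, a ≠ 0 → IsUnit (f a)) :
    ∃ F : SkewFrac A →+* T, ∀ a, F (SkewFrac.of A a) = f a := by
  let fS : A⁰ →* Tˣ := IsUnit.liftRight ((f : A →* T).comp A⁰.subtype)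
    fun s => hf s (nonZeroDivisors.coe_ne_zero s)
  exact ⟨OreLocalization.universalHom f fS fun s => rfl,
    fun a => OreLocalization.universalHom_commutes f fS _⟩

/-- A division subring of the skew field of fractions that contains the Ore domain is everything. -/
lemma mem_of_forall_of_mem (L : Subfield (SkewFrac A)) (h : ∀ a, SkewFrac.of A a ∈ L)
    (d : SkewFrac A) : d ∈ L := by
  obtain ⟨a, b, -, rfl⟩ := exists_eq_inv_mul d
  exact L.mul_mem (L.inv_mem (h b)) (h a)

end SkewFrac

/-! ## Reduced products -/

section ReducedProduct

variable {Φ : Type*} (l : Filter Φ) (D : Φ → Type*) [∀ φ, Ring (D φ)]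

/-- The ideal of the sections that vanish eventually. -/
def eventuallyZero : Ideal (∀ φ, D φ) where
  carrier := {f | ∀ᶠ φ in l, f φ = 0}
  zero_mem' := Filter.Eventually.of_forall fun _ => rfl
  add_mem' := by
    intro f g hf hg
    filter_upwards [hf, hg] with φ h₁ h₂
    rw [Pi.add_apply, h₁, h₂, add_zero]
  smul_mem' := by
    intro c f hf
    filter_upwards [hf] with φ h
    rw [smul_eq_mul, Pi.mul_apply, h, mul_zero]

instance : (eventuallyZero l D).IsTwoSided where
  mul_mem_of_left := by
    intro f g hf
    filter_upwards [show ∀ᶠ φ in l, f φ = 0 from hf] with φ h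
    rw [Pi.mul_apply, h, zero_mul]

variable {l D}

lemma mk_eventuallyZero_eq_iff {f g : ∀ φ, D φ} :
    Ideal.Quotient.mk (eventuallyZero l D) f = Ideal.Quotient.mk (eventuallyZero l D) g ↔
      ∀ᶠ φ in l, f φ = g φ := by
  rw [Ideal.Quotient.eq]
  exact Filter.eventually_congr (Filter.Eventually.of_forall fun φ => sub_eq_zero)

end ReducedProduct

/-- The filter need not be an ultrafilter, so the quotient need not be a division ring. Inverses are
taken pointwise, and the value `0⁻¹ = 0` at exceptional points is harmless. -/
lemma isUnit_mk_eventuallyZero_iff {Φ : Type*} {l : Filter Φ} {D : Φ → Type*}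
    [∀ φ, DivisionRing (D φ)] {f : ∀ φ, D φ} :
    IsUnit (Ideal.Quotient.mk (eventuallyZero l D) f) ↔ ∀ᶠ φ in l, f φ ≠ 0 := by
  constructor
  · intro h
    obtain ⟨g, hg⟩ := h.exists_right_inv
    obtain ⟨g, rfl⟩ := Ideal.Quotient.mk_surjective g
    rw [← map_mul, ← map_one (Ideal.Quotient.mk (eventuallyZero l D)),
      mk_eventuallyZero_eq_iff] at hg
    filter_upwards [hg] with φ h
    exact left_ne_zero_of_mul_eq_one h
  · intro h
    refine isUnit_iff_exists.mpr ⟨Ideal.Quotient.mk _ fun φ => (f φ)⁻¹, ?_, ?_⟩ <;>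
      rw [← map_mul, ← map_one (Ideal.Quotient.mk (eventuallyZero l D)),
        mk_eventuallyZero_eq_iff]
    · filter_upwards [h] with φ h
      exact mul_inv_cancel₀ h
    · filter_upwards [h] with φ h
      exact inv_mul_cancel₀ h

/-! ## Generic specializations of a field -/

/-- A map of a field `k₀` to an algebraically closed field of characteristic zero. -/
structure ScalarMap (k₀ : Type u) where
  k : Type u
  [field : Field k]
  [isAlgClosed : IsAlgClosed k]
  [charZero : CharZero k]
  val : k₀ → k

attribute [instance] ScalarMap.field ScalarMap.isAlgClosed ScalarMap.charZero

/-- The algebra `A_k = k ⊗ A_ℤ`. -/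
abbrev BaseChangeRing (k : Type u) [Field k] (R : Type v) [Ring R] : Type (max u v) := k ⊗[ℤ] R

namespace ScalarMap

variable {k₀ : Type u} [Field k₀]

/-- The maps that respect the ring operations on a finite set `s` as far as they stay in `s`, and
that do not kill a nonzero element of `s`. -/
def partialHoms (s : Finset k₀) : Set (ScalarMap k₀) :=
  {φ | (∀ a ∈ s, ∀ b ∈ s, a + b ∈ s → φ.val (a + b) = φ.val a + φ.val b) ∧
    (∀ a ∈ s, ∀ b ∈ s, a * b ∈ s → φ.val (a * b) = φ.val a * φ.val b) ∧
    (1 ∈ s → φ.val 1 = 1) ∧ ∀ a ∈ s, a ≠ 0 → φ.val a ≠ 0}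

lemma partialHoms_anti {s t : Finset k₀} (h : s ⊆ t) : partialHoms t ⊆ partialHoms s :=
  fun _ ⟨h₁, h₂, h₃, h₄⟩ => ⟨fun a ha b hb hab => h₁ a (h ha) b (h hb) (h hab),
    fun a ha b hb hab => h₂ a (h ha) b (h hb) (h hab), fun h1 => h₃ (h h1),
    fun a ha => h₄ a (h ha)⟩

variable (k₀) in
/-- The filter of the maps that respect more and more of the structure of `k₀`. -/
def generic : Filter (ScalarMap k₀) := ⨅ s : Finset k₀, Filter.principal (partialHoms s)

/-- Every eventual property is governed by a single finite subset of `k₀`; this finally yields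
finitely many equations. -/
lemma eventually_generic_iff {P : ScalarMap k₀ → Prop} :
    (∀ᶠ φ in generic k₀, P φ) ↔ ∃ s : Finset k₀, ∀ φ ∈ partialHoms s, P φ := by
  classical
  have hd : Directed (· ≥ ·) fun s : Finset k₀ => Filter.principal (partialHoms s) := by
    intro s t
    exact ⟨s ∪ t, Filter.principal_mono.mpr (partialHoms_anti Finset.subset_union_left),
      Filter.principal_mono.mpr (partialHoms_anti Finset.subset_union_right)⟩
  rw [generic, Filter.Eventually, Filter.mem_iInf_of_directed hd]
  rfl

lemma eventually_val_add (a b : k₀) :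
    ∀ᶠ φ in generic k₀, φ.val (a + b) = φ.val a + φ.val b := by
  classical
  exact eventually_generic_iff.mpr ⟨{a, b, a + b}, fun φ hφ =>
    hφ.1 a (by simp) b (by simp) (by simp)⟩

lemma eventually_val_mul (a b : k₀) :
    ∀ᶠ φ in generic k₀, φ.val (a * b) = φ.val a * φ.val b := by
  classical
  exact eventually_generic_iff.mpr ⟨{a, b, a * b}, fun φ hφ =>
    hφ.2.1 a (by simp) b (by simp) (by simp)⟩

lemma eventually_val_one : ∀ᶠ φ in generic k₀, φ.val 1 = 1 :=
  eventually_generic_iff.mpr ⟨{1}, fun _ hφ => hφ.2.2.1 (by simp)⟩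

lemma eventually_val_ne_zero {a : k₀} (ha : a ≠ 0) : ∀ᶠ φ in generic k₀, φ.val a ≠ 0 :=
  eventually_generic_iff.mpr ⟨{a}, fun _ hφ => hφ.2.2.2 a (by simp) ha⟩

lemma eventually_val_zero : ∀ᶠ φ in generic k₀, φ.val 0 = 0 := by
  filter_upwards [eventually_val_add (0 : k₀) 0] with φ h
  simpa using h

/-- The value of `∑ c ⊗ r` under a map of scalars. -/
def eval {R : Type v} [Ring R] (φ : ScalarMap k₀) (f : k₀ →₀ R) : φ.k ⊗[ℤ] R :=
  f.sum fun c r => φ.val c ⊗ₜ r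

end ScalarMap

/-- The element `∑ c ⊗ r` of `k ⊗ R`. -/
def tensorSum {k : Type u} [Field k] {R : Type v} [Ring R] (f : k →₀ R) : k ⊗[ℤ] R :=
  f.sum fun c r => c ⊗ₜ r

/-- A map of scalars is not additive and induces no map of tensor products. Only chosen
representatives `∑ c ⊗ r` can be specialized. -/
lemma tensorSum_surjective {k : Type u} [Field k] {R : Type v} [Ring R] (x : k ⊗[ℤ] R) :
    ∃ f : k →₀ R, tensorSum f = x := by
  induction x with
  | zero => exact ⟨0, Finsupp.sum_zero_index⟩
  | tmul c r => exact ⟨Finsupp.single c r, Finsupp.sum_single_index (TensorProduct.tmul_zero _ _)⟩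
  | add x y hx hy =>
    obtain ⟨f, rfl⟩ := hx
    obtain ⟨g, rfl⟩ := hy
    exact ⟨f + g, Finsupp.sum_add_index' (fun _ => TensorProduct.tmul_zero _ _)
      fun _ => TensorProduct.tmul_add _⟩

/-! ## Spreading out -/

section Spread

open ScalarMap

variable {R : Type v} [Ring R] {k₀ : Type u} [Field k₀]

variable (R) in
/-- The homomorphisms of `A_k` to a `k`-algebra. -/
abbrev BaseChangeHom (k : Type u) [Field k] (D : Type*) [Ring D] [Algebra k D] : Type _ :=
  AlgHom k (BaseChangeRing k R) D

variable (R) in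
/-- A family of homomorphisms of the algebras `A_k` to `k`-algebras. -/
abbrev HomFamily (D : ScalarMap k₀ → Type*) [∀ φ, Ring (D φ)] [∀ φ, Algebra φ.k (D φ)] : Type _ :=
  ∀ φ : ScalarMap k₀, BaseChangeHom R φ.k (D φ)

section Reduced

variable {D : ScalarMap k₀ → Type*} [∀ φ, Ring (D φ)] [∀ φ, Algebra φ.k (D φ)]

variable (D) in
/-- The scalars of the reduced product of a family of algebras. -/
def scalarsToReduced : k₀ →+* (∀ φ, D φ) ⧸ eventuallyZero (generic k₀) D where
  toFun c := Ideal.Quotient.mk _ fun φ => algebraMap φ.k (D φ) (φ.val c)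
  map_zero' := by
    rw [← map_zero (Ideal.Quotient.mk _), mk_eventuallyZero_eq_iff]
    filter_upwards [eventually_val_zero (k₀ := k₀)] with φ h
    rw [h, map_zero, Pi.zero_apply]
  map_one' := by
    rw [← map_one (Ideal.Quotient.mk _), mk_eventuallyZero_eq_iff]
    filter_upwards [eventually_val_one (k₀ := k₀)] with φ h
    rw [h, map_one, Pi.one_apply]
  map_add' a b := by
    rw [← map_add (Ideal.Quotient.mk _), mk_eventuallyZero_eq_iff]
    filter_upwards [eventually_val_add a b] with φ h
    rw [h, map_add, Pi.add_apply]
  map_mul' a b := by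
    rw [← map_mul (Ideal.Quotient.mk _), mk_eventuallyZero_eq_iff]
    filter_upwards [eventually_val_mul a b] with φ h
    rw [h, map_mul, Pi.mul_apply]

variable (ρ : HomFamily R D)

/-- The constant elements of the reduced product. -/
def constantsToReduced : R →+* (∀ φ, D φ) ⧸ eventuallyZero (generic k₀) D :=
  (Ideal.Quotient.mk _).comp (RingHom.pi fun φ : ScalarMap k₀ =>
    (ρ φ : BaseChangeRing φ.k R →+* D φ).comp
      ((Algebra.TensorProduct.includeRight : R →ₐ[ℤ] BaseChangeRing φ.k R) :
        R →+* BaseChangeRing φ.k R))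

/-- The homomorphism of `A_{k₀}` to the reduced product. -/
def toReduced : BaseChangeRing k₀ R →+* (∀ φ, D φ) ⧸ eventuallyZero (generic k₀) D :=
  (Algebra.TensorProduct.lift (scalarsToReduced D).toIntAlgHom
    (constantsToReduced ρ).toIntAlgHom (by
      intro c r
      change Ideal.Quotient.mk (eventuallyZero (generic k₀) D) _ * Ideal.Quotient.mk _ _ =
        Ideal.Quotient.mk _ _ * Ideal.Quotient.mk _ _
      rw [← map_mul, ← map_mul]
      congr 1
      funext φ
      exact Algebra.commutes _ _) :
    AlgHom ℤ (BaseChangeRing k₀ R) ((∀ φ, D φ) ⧸ eventuallyZero (generic k₀) D))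

lemma toReduced_tmul (c : k₀) (r : R) : toReduced ρ (c ⊗ₜ r) =
    Ideal.Quotient.mk _ fun φ => ρ φ (φ.val c ⊗ₜ r) := by
  change Ideal.Quotient.mk (eventuallyZero (generic k₀) D) _ * Ideal.Quotient.mk _ _ = _
  rw [← map_mul]
  congr 1
  funext φ
  change algebraMap φ.k (D φ) (φ.val c) * ρ φ ((1 : φ.k) ⊗ₜ r) = _
  rw [← (ρ φ).commutes, ← map_mul, Algebra.TensorProduct.algebraMap_apply,
    Algebra.TensorProduct.tmul_mul_tmul, mul_one, one_mul]
  rfl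

lemma toReduced_sum {ι : Type*} (s : Finset ι) (c : ι → k₀) (r : ι → R) :
    toReduced ρ (∑ i ∈ s, c i ⊗ₜ r i) = Ideal.Quotient.mk _ fun φ : ScalarMap k₀ =>
      ρ φ (∑ i ∈ s, φ.val (c i) ⊗ₜ r i) := by
  rw [map_sum, Finset.sum_congr rfl fun i _ => toReduced_tmul ρ (c i) (r i), ← map_sum]
  congr 1
  funext φ
  rw [Finset.sum_apply, map_sum]

end Reduced

variable {D : ScalarMap k₀ → Type*} [∀ φ, DivisionRing (D φ)] [∀ φ, Algebra φ.k (D φ)]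
  (ρ : HomFamily R D)

/-- In a `ℤ`-basis of a filtration piece, a nonzero element has a nonzero coordinate, which
eventually stays nonzero. The specialized element is then nonzero in `k ⊗ A_i`, which embeds in
`A_k` and further in `D φ`. -/
lemma isUnit_toReduced {F : ℕ → Submodule ℤ R} (hF : IsIntegralFiltration.{u} R F)
    (hρ : ∀ φ, Function.Injective (ρ φ)) {x : BaseChangeRing k₀ R} (hx : x ≠ 0) :
    IsUnit (toReduced ρ x) := by
  -- The index is taken positive because freeness is available only for `i ≥ 1`.
  obtain ⟨i, hi, y, rfl⟩ : ∃ i, 1 ≤ i ∧ ∃ y, LinearMap.lTensor k₀ (F i).subtype y = x := by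
    clear hx
    induction x using TensorProduct.induction_on with
    | zero => exact ⟨1, le_rfl, 0, map_zero _⟩
    | tmul c r =>
      obtain ⟨i, hi⟩ := hF.exhaustive r
      exact ⟨i + 1, by omega, c ⊗ₜ ⟨r, hF.mono (Nat.le_succ i) hi⟩, rfl⟩
    | add x y hx hy =>
      obtain ⟨i, hi, x, rfl⟩ := hx
      obtain ⟨j, hj, y, rfl⟩ := hy
      refine ⟨max i j, le_max_of_le_left hi,
        LinearMap.lTensor k₀ (Submodule.inclusion (hF.mono (le_max_left i j))) x +
        LinearMap.lTensor k₀ (Submodule.inclusion (hF.mono (le_max_right i j))) y, ?_⟩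
      rw [map_add, ← LinearMap.comp_apply, ← LinearMap.comp_apply, ← LinearMap.lTensor_comp,
        ← LinearMap.lTensor_comp, Submodule.subtype_comp_inclusion,
        Submodule.subtype_comp_inclusion]
  have := hF.free i hi
  have := hF.finite i hi
  let b := Module.Free.chooseBasis ℤ (F i)
  have hsum : ∀ (k : Type u) [Field k] (c : Module.Free.ChooseBasisIndex ℤ (F i) → k),
      LinearMap.lTensor k (F i).subtype (∑ j, c j ⊗ₜ b j) = ∑ j, c j ⊗ₜ (b j : R) := by
    intro k _ c
    simp
  have hsmul : ∀ (k : Type u) [Field k] (c : Module.Free.ChooseBasisIndex ℤ (F i) → k),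
      ∑ j, c j ⊗ₜ b j = ∑ j, c j • Algebra.TensorProduct.basis k b j := by
    intro k _ c
    simp [TensorProduct.smul_tmul']
  set c := (Algebra.TensorProduct.basis k₀ b).repr y with hc
  have hy : y = ∑ j, c j ⊗ₜ b j := by
    rw [hsmul k₀ c]
    exact ((Algebra.TensorProduct.basis k₀ b).sum_repr y).symm
  obtain ⟨j, hj⟩ : ∃ j, c j ≠ 0 := by
    by_contra! h
    refine hx ?_
    rw [hy, Finset.sum_eq_zero fun j _ => by rw [h j, TensorProduct.zero_tmul], map_zero]
  rw [hy, hsum, toReduced_sum, isUnit_mk_eventuallyZero_iff]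
  filter_upwards [eventually_val_ne_zero hj] with φ hφ
  refine (map_ne_zero_iff _ (hρ φ)).mpr ?_
  rw [← hsum φ.k fun j => φ.val (c j)]
  refine (map_ne_zero_iff _ (hF.baseChange_injective φ.k i)).mpr fun h => hφ ?_
  rw [hsmul] at h
  exact Fintype.linearIndependent_iff.mp (Algebra.TensorProduct.basis φ.k b).linearIndependent
    _ h j

variable {D₀ : Type*} [DivisionRing D₀] [Algebra k₀ D₀] (ρ₀ : BaseChangeHom R k₀ D₀)

/-- A compatible choice of specializations of the elements of `D₀ = Frac A_{k₀}`: it respects each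
algebraic relation at almost all specializations of the scalars. -/
structure IsSpreading (σ : D₀ → ∀ φ, D φ) : Prop where
  add : ∀ d e, ∀ᶠ φ in generic k₀, σ (d + e) φ = σ d φ + σ e φ
  mul : ∀ d e, ∀ᶠ φ in generic k₀, σ (d * e) φ = σ d φ * σ e φ
  map_algebraMap : ∀ c : k₀, ∀ᶠ φ in generic k₀,
    σ (algebraMap k₀ D₀ c) φ = algebraMap φ.k (D φ) (φ.val c)
  map_tensorSum : ∀ f : k₀ →₀ R, ∀ᶠ φ in generic k₀, σ (ρ₀ (tensorSum f)) φ = ρ φ (φ.eval f)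
  map_const : ∀ r : R, ∀ᶠ φ in generic k₀, σ (ρ₀ (1 ⊗ₜ r)) φ = ρ φ (1 ⊗ₜ r)
  ne_zero : ∀ d, d ≠ 0 → ∀ᶠ φ in generic k₀, σ d φ ≠ 0

variable {ρ ρ₀}

/-- `σ` chooses representatives of `Θ`. An identity in the reduced product means eventual equality
of representatives, and a nonzero element has a unit as image, hence is eventually nonzero. -/
theorem exists_isSpreading (Θ : D₀ →+* (∀ φ, D φ) ⧸ eventuallyZero (generic k₀) D)
    (hΘ : ∀ x, Θ (ρ₀ x) = toReduced ρ x) : ∃ σ : D₀ → ∀ φ, D φ, IsSpreading ρ ρ₀ σ := by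
  choose σ hσ using fun d => Ideal.Quotient.mk_surjective (Θ d)
  refine ⟨σ, fun d e => ?_, fun d e => ?_, fun c => ?_, fun f => ?_, fun r => ?_, fun d hd => ?_⟩
  · refine mk_eventuallyZero_eq_iff.mp ?_
    change _ = Ideal.Quotient.mk _ (σ d + σ e)
    rw [map_add, hσ, hσ, hσ, map_add]
  · refine mk_eventuallyZero_eq_iff.mp ?_
    change _ = Ideal.Quotient.mk _ (σ d * σ e)
    rw [map_mul, hσ, hσ, hσ, map_mul]
  · refine mk_eventuallyZero_eq_iff.mp ?_
    rw [hσ, ← ρ₀.commutes, hΘ, Algebra.TensorProduct.algebraMap_apply, toReduced_tmul]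
    congr 1
    funext φ
    exact (ρ φ).commutes (φ.val c)
  · refine mk_eventuallyZero_eq_iff.mp ?_
    rw [hσ, hΘ]
    exact toReduced_sum ρ f.support id f
  · refine mk_eventuallyZero_eq_iff.mp ?_
    rw [hσ, hΘ, toReduced_tmul, mk_eventuallyZero_eq_iff]
    filter_upwards [eventually_val_one (k₀ := k₀)] with φ h
    rw [h]
  · rw [← isUnit_mk_eventuallyZero_iff, hσ]
    exact (IsUnit.mk0 d hd).map Θ

namespace IsSpreading

variable {σ : D₀ → ∀ φ, D φ}

lemma zero (hσ : IsSpreading ρ ρ₀ σ) : ∀ᶠ φ in generic k₀, σ 0 φ = 0 := by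
  filter_upwards [hσ.add 0 0] with φ h
  simpa using h

lemma one (hσ : IsSpreading ρ ρ₀ σ) : ∀ᶠ φ in generic k₀, σ 1 φ = 1 := by
  filter_upwards [hσ.map_algebraMap 1, eventually_val_one (k₀ := k₀)] with φ h h1
  rwa [h1, map_one, map_one] at h

lemma inv (hσ : IsSpreading ρ ρ₀ σ) (d : D₀) :
    ∀ᶠ φ in generic k₀, σ d⁻¹ φ = (σ d φ)⁻¹ := by
  by_cases hd : d = 0
  · subst hd
    rw [inv_zero]
    filter_upwards [hσ.zero] with φ h
    rw [h, inv_zero]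
  · have h := hσ.mul d d⁻¹
    rw [mul_inv_cancel₀ hd] at h
    filter_upwards [h, hσ.one] with φ h h1
    rw [h1] at h
    exact eq_inv_of_mul_eq_one_right h.symm

lemma pow (hσ : IsSpreading ρ ρ₀ σ) (d : D₀) (n : ℕ) :
    ∀ᶠ φ in generic k₀, σ (d ^ n) φ = σ d φ ^ n := by
  induction n with
  | zero => simpa using hσ.one
  | succ n ih =>
    filter_upwards [ih, hσ.mul (d ^ n) d] with φ h₁ h₂
    rw [pow_succ, h₂, h₁, pow_succ]

lemma sum (hσ : IsSpreading ρ ρ₀ σ) {ι : Type*} (s : Finset ι) (f : ι → D₀) :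
    ∀ᶠ φ in generic k₀, σ (∑ i ∈ s, f i) φ = ∑ i ∈ s, σ (f i) φ := by
  classical
  induction s using Finset.induction_on with
  | empty => simpa using hσ.zero
  | insert i s hi ih =>
    filter_upwards [ih, hσ.add (f i) (∑ i ∈ s, f i)] with φ h₁ h₂
    rw [Finset.sum_insert hi, h₂, h₁, Finset.sum_insert hi]

end IsSpreading

end Spread

/-! ## The Weyl algebra -/

namespace WeylAlgebra

variable {n : ℕ} {K : Type*} [Field K]

/-- The generators of the Weyl algebra. -/
def gen (i : Fin n ⊕ Fin n) : WeylAlgebra n K :=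
  RingQuot.mkAlgHom K (WeylRel n K) (FreeAlgebra.ι K i)

lemma isWeylTuple_gen : IsWeylTuple (gen : Fin n ⊕ Fin n → WeylAlgebra n K) where
  xx i j := by
    simp only [gen, ← map_mul]
    exact RingQuot.mkAlgHom_rel K (WeylRel.xx i j)
  yy i j := by
    simp only [gen, ← map_mul]
    exact RingQuot.mkAlgHom_rel K (WeylRel.yy i j)
  yx i j := by
    have h := RingQuot.mkAlgHom_rel K (WeylRel.yx (K := K) i j)
    rw [map_add, map_mul, map_mul] at h
    rw [gen, gen, h]
    split_ifs <;> simp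

lemma adjoin_gen : Algebra.adjoin K (Set.range (gen : Fin n ⊕ Fin n → WeylAlgebra n K)) = ⊤ := by
  have h : (⊤ : Subalgebra K (WeylAlgebra n K)) =
      (⊤ : Subalgebra K (FreeAlgebra K (Fin n ⊕ Fin n))).map
        (RingQuot.mkAlgHom K (WeylRel n K)) := by
    rw [Algebra.map_top]
    exact ((AlgHom.range_eq_top _).mpr (RingQuot.mkAlgHom_surjective K (WeylRel n K))).symm
  rw [h, ← FreeAlgebra.adjoin_range_ι, AlgHom.map_adjoin, ← Set.range_comp]
  rfl

lemma mem_adjoin_gen (a : WeylAlgebra n K) :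
    a ∈ Algebra.adjoin K (Set.range (gen : Fin n ⊕ Fin n → WeylAlgebra n K)) :=
  adjoin_gen (n := n) (K := K) ▸ Algebra.mem_top

/-- The homomorphism out of the Weyl algebra that is given by a Weyl tuple. -/
def lift {D : Type*} [Ring D] [Algebra K D] {w : Fin n ⊕ Fin n → D} (hw : IsWeylTuple w) :
    WeylAlgebra n K →ₐ[K] D :=
  RingQuot.liftAlgHom K ⟨FreeAlgebra.lift K w, by
    intro a b h
    induction h with
    | xx i j => simpa using hw.xx i j
    | yy i j => simpa using hw.yy i j
    | yx i j =>
      have h := hw.yx i j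
      split_ifs with hij <;> simpa [hij] using h⟩

lemma lift_gen {D : Type*} [Ring D] [Algebra K D] {w : Fin n ⊕ Fin n → D} (hw : IsWeylTuple w)
    (i : Fin n ⊕ Fin n) : lift (K := K) hw (gen i) = w i := by
  simp [lift, gen]

end WeylAlgebra

/-! ## Presentations of Weyl fields -/

section Presentation

variable (k : Type*) [Field k] {D : Type*} [DivisionRing D] [Algebra k D]

/-- The subalgebra that is generated by the `w`'s and by the fractions of polynomials in the
`t`'s. -/
def weylAdjoin {n l : ℕ} (w : Fin n ⊕ Fin n → D) (t : Fin l → D) : Subalgebra k D :=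
  -- Here `q = 0` is allowed and contributes `0`, so no denominator has to be watched under
  -- specialization.
  Algebra.adjoin k (Set.range w ∪ {x | ∃ p ∈ Algebra.adjoin k (Set.range t),
    ∃ q ∈ Algebra.adjoin k (Set.range t), x = p * q⁻¹})

/-- The Weyl tuple `w` and the central elements `t` generate a division ring that contains the
elements `e`, and the elements `c` are algebraic over the `t`'s. -/
structure IsWeylPresentation {n l : ℕ} {ι κ : Type*} (w : Fin n ⊕ Fin n → D) (t : Fin l → D)
    (e : ι → D) (c : κ → D) : Prop where
  weyl : IsWeylTuple w
  comm_gen : ∀ i j, t i * e j = e j * t i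
  -- Independence of the `t`'s would be infinitely many conditions. Algebraicity of each `c i` over
  -- them is one equation, and independence is recovered from it by counting.
  algebraic : ∀ i, ∃ (m : ℕ) (f : ℕ → D), (∀ j, f j ∈ Algebra.adjoin k (Set.range t)) ∧
    (∃ j ∈ Finset.range m, f j ≠ 0) ∧ ∑ j ∈ Finset.range m, f j * c i ^ j = 0
  exists_frac : ∀ j, ∃ p ∈ weylAdjoin k w t, ∃ q ∈ weylAdjoin k w t, q ≠ 0 ∧ q * e j = p

variable {k}

/-- The centralizer of an element of a division ring. -/
def divisionCentralizer (a : D) : Subfield D where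
  carrier := {d | Commute a d}
  one_mem' := Commute.one_right a
  zero_mem' := Commute.zero_right a
  mul_mem' := fun h₁ h₂ => Commute.mul_right h₁ h₂
  add_mem' := fun h₁ h₂ => Commute.add_right h₁ h₂
  neg_mem' := fun h => Commute.neg_right h
  inv_mem' := fun _ h => Commute.inv_right₀ h

lemma isUnit_center {z : Subalgebra.center k D} (hz : z ≠ 0) : IsUnit z := by
  have hz' : (z : D) ≠ 0 := fun h => hz (Subtype.ext h)
  have hinv : (z : D)⁻¹ ∈ Subalgebra.center k D := by
    rw [Subalgebra.mem_center_iff]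
    intro b
    exact (Commute.inv_right₀ (Subalgebra.mem_center_iff.mp z.2 b)).eq
  exact isUnit_iff_exists.mpr ⟨⟨_, hinv⟩, Subtype.ext (mul_inv_cancel₀ hz'),
    Subtype.ext (inv_mul_cancel₀ hz')⟩

lemma coe_mem_adjoin {l : ℕ} {t : Fin l → Subalgebra.center k D} {z : Subalgebra.center k D}
    (hz : z ∈ Algebra.adjoin k (Set.range t)) :
    (z : D) ∈ Algebra.adjoin k (Set.range fun i => (t i : D)) := by
  have h := Subalgebra.mem_map.mpr ⟨z, hz, (rfl : (Subalgebra.center k D).val z = z)⟩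
  rwa [AlgHom.map_adjoin, ← Set.range_comp] at h

lemma exists_coe_eq_of_mem_adjoin {l : ℕ} {t : Fin l → Subalgebra.center k D} {x : D}
    (hx : x ∈ Algebra.adjoin k (Set.range fun i => (t i : D))) :
    ∃ z ∈ Algebra.adjoin k (Set.range t), (z : D) = x := by
  have h : Algebra.adjoin k (Set.range fun i => (t i : D)) =
      (Algebra.adjoin k (Set.range t)).map (Subalgebra.center k D).val := by
    rw [AlgHom.map_adjoin, ← Set.range_comp]
    rfl
  rw [h] at hx
  exact Subalgebra.mem_map.mp hx

/-- Rephrases algebraicity inside `D` rather than its centre, since a spreading acts on elements of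
the division ring. -/
lemma isAlgebraic_center_iff {l : ℕ} (t : Fin l → Subalgebra.center k D)
    (z : Subalgebra.center k D) :
    IsAlgebraic (Algebra.adjoin k (Set.range t)) z ↔ ∃ (m : ℕ) (f : ℕ → D),
      (∀ j, f j ∈ Algebra.adjoin k (Set.range fun i => (t i : D))) ∧
      (∃ j ∈ Finset.range m, f j ≠ 0) ∧ ∑ j ∈ Finset.range m, f j * (z : D) ^ j = 0 := by
  constructor
  · rintro ⟨p, hp0, hp⟩
    refine ⟨p.natDegree + 1, fun j => ((p.coeff j : Subalgebra.center k D) : D),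
      fun j => coe_mem_adjoin (p.coeff j).2, ⟨p.natDegree, by simp, fun h => hp0 ?_⟩, ?_⟩
    · rw [← Polynomial.leadingCoeff_eq_zero]
      exact Subtype.ext (Subtype.ext h)
    · rw [Polynomial.aeval_eq_sum_range] at hp
      have h := congrArg (Subalgebra.center k D).val hp
      rw [map_sum, map_zero] at h
      exact h
  · rintro ⟨m, f, hf, ⟨j, hj, hj0⟩, hsum⟩
    choose g hg hgf using fun j => exists_coe_eq_of_mem_adjoin (hf j)
    let g' : ℕ → Algebra.adjoin k (Set.range t) := fun j => ⟨g j, hg j⟩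
    refine ⟨∑ i ∈ Finset.range m, Polynomial.monomial i (g' i), fun h => hj0 ?_, ?_⟩
    · have h2 := congrArg (fun p => Polynomial.coeff p j) h
      simp only [Polynomial.finsetSum_coeff, Polynomial.coeff_monomial, Polynomial.coeff_zero,
        Finset.sum_ite_eq', hj, if_true] at h2
      rw [← hgf]
      exact congrArg (fun a : Algebra.adjoin k (Set.range t) =>
        ((a : Subalgebra.center k D) : D)) h2
    · apply Subtype.ext
      rw [map_sum, ← Subalgebra.coe_val, map_sum, Subalgebra.coe_val, Subalgebra.coe_zero, ← hsum]
      refine Finset.sum_congr rfl fun i _ => ?_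
      rw [Polynomial.aeval_monomial, ← hgf]
      rfl

/-- Elements of a commutative domain over which as many algebraically independent elements are
algebraic are algebraically independent. -/
lemma algebraicIndependent_of_isAlgebraic {Z : Type*} [CommRing Z] [IsDomain Z] [Algebra k Z]
    {l : ℕ} {c t : Fin l → Z} (hc : AlgebraicIndependent k c)
    (h : ∀ i, IsAlgebraic (Algebra.adjoin k (Set.range t)) (c i)) : AlgebraicIndependent k t := by
  -- In the matroid of algebraic independence, the closure of `t` contains an independent set of
  -- size `l`. So `t`, with at most `l` elements, has rank `l`: it is independent and without
  -- repetitions.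
  set M := AlgebraicIndependent.matroid k Z
  have hcM : M.Indep (Set.range c) := AlgebraicIndependent.matroid_indep_iff.mpr hc.to_subtype_range
  have hsub : Set.range c ⊆ M.closure (Set.range t) := by
    rw [AlgebraicIndependent.matroid_closure_eq]
    rintro _ ⟨i, rfl⟩
    exact h i
  have hle : (l : ℕ∞) ≤ M.eRk (Set.range t) := by
    have h1 := M.eRk_mono hsub
    rwa [M.eRk_closure_eq, hcM.eRk_eq_encard, ← Set.image_univ,
      hc.injective.encard_image, Set.encard_univ, ENat.card_eq_coe_fintype_card,
      Fintype.card_fin] at h1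
  have hcard : (Set.range t).encard ≤ l := by
    rw [← Set.image_univ]
    refine (Set.encard_image_le _ _).trans ?_
    rw [Set.encard_univ, ENat.card_eq_coe_fintype_card, Fintype.card_fin]
  have heq : M.eRk (Set.range t) = (Set.range t).encard :=
    le_antisymm (M.eRk_le_encard _) (hcard.trans hle)
  have hind := (M.indep_iff_eRk_eq_encard_of_finite (Set.finite_range t)).mpr heq
  have hinj : Function.Injective t := by
    have h2 : (Set.univ : Set (Fin l)).encard ≤ (t '' Set.univ).encard := by
      rw [Set.image_univ, Set.encard_univ, ENat.card_eq_coe_fintype_card, Fintype.card_fin]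
      exact hle.trans heq.le
    have h3 : (t '' Set.univ).encard = (Set.univ : Set (Fin l)).encard :=
      le_antisymm (Set.encard_image_le _ _) h2
    exact Set.injOn_univ.mp ((Set.finite_univ).injOn_of_encard_image_eq h3)
  exact .of_subtype_range hinj (AlgebraicIndependent.matroid_indep_iff.mp hind)

end Presentation

namespace IsWeylPresentation

section

variable {k : Type*} [Field k] {D : Type*} [DivisionRing D] [Algebra k D] {n l : ℕ}
  {ι κ : Type*}

/-- A Weyl presentation exhibits a division ring as a Weyl field if there are as many central
elements that are algebraically independent. -/
theorem isWeylField [CharZero k] {w : Fin n ⊕ Fin n → D} {t : Fin l → D} {e : ι → D}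
    {c : Fin l → Subalgebra.center k D} (h : IsWeylPresentation k w t e fun i => (c i : D))
    (hc : AlgebraicIndependent k c)
    (hgen : ∀ L : Subfield D, (∀ a : k, algebraMap k D a ∈ L) → (∀ j, e j ∈ L) → ∀ d, d ∈ L) :
    IsWeylField k n l D ∧ ∀ d : D,
      ∃ p ∈ Algebra.adjoin k (Set.range w ∪ (Subalgebra.center k D : Set D)),
      ∃ q ∈ Algebra.adjoin k (Set.range w ∪ (Subalgebra.center k D : Set D)),
        q ≠ 0 ∧ q * d = p := by
  -- The centralizer of `t i` is a division subring containing the scalars and the `e j`, hence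
  -- everything.
  have htc : ∀ i, t i ∈ Subalgebra.center k D := by
    intro i
    rw [Subalgebra.mem_center_iff]
    intro d
    exact (hgen (divisionCentralizer (t i)) (fun a => (Algebra.commutes a (t i)).symm)
      (fun j => h.comm_gen i j) d).symm
  let t' : Fin l → Subalgebra.center k D := fun i => ⟨t i, htc i⟩
  have ht' : AlgebraicIndependent k t' :=
    algebraicIndependent_of_isAlgebraic hc fun i =>
      (isAlgebraic_center_iff t' (c i)).mpr (h.algebraic i)
  let κ : RationalFunctions l k →ₐ[k] Subalgebra.center k D :=
    IsLocalization.liftAlgHom (M := (MvPolynomial (Fin l) k)⁰) (f := MvPolynomial.aeval t')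
      fun y => isUnit_center ((map_ne_zero_iff _ ht').mpr (nonZeroDivisors.coe_ne_zero y))
  have hκ : ∀ p : MvPolynomial (Fin l) k, κ (algebraMap _ _ p) = MvPolynomial.aeval t' p :=
    fun p => IsLocalization.lift_eq _ p
  let : Algebra (RationalFunctions l k) D :=
    (((Subalgebra.center k D).val.comp κ : RationalFunctions l k →ₐ[k] D) :
      RationalFunctions l k →+* D).toAlgebra' fun a d =>
        (Subalgebra.mem_center_iff.mp (κ a).2 d).symm
  have halg : ∀ a, algebraMap (RationalFunctions l k) D a = κ a := fun _ => rfl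
  have : IsScalarTower k (RationalFunctions l k) D :=
    IsScalarTower.of_algebraMap_eq fun a => by
      rw [halg, AlgHom.commutes]
      rfl
  let f : WeylAlgebraRat n l k →ₐ[RationalFunctions l k] D := WeylAlgebra.lift h.weyl
  -- Simplicity is applied over the field `k(t)`, not over `k`.
  have hf : Function.Injective f :=
    WeylAlgebra.isWeylTuple_gen.injective_of_adjoin_eq_top WeylAlgebra.adjoin_gen f
  have : IsDomain (WeylAlgebraRat n l k) := hf.isDomain f.toRingHom
  have hS : ∀ a ∈ (f : WeylAlgebraRat n l k →+* D).range,
      ∀ b ∈ (f : WeylAlgebraRat n l k →+* D).range, b ≠ 0 →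
        ∃ c ∈ (f : WeylAlgebraRat n l k →+* D).range,
        ∃ d ∈ (f : WeylAlgebraRat n l k →+* D).range, d ≠ 0 ∧ d * a = c * b := by
    rintro _ ⟨a, rfl⟩ _ ⟨b, rfl⟩ hb
    obtain ⟨c, d, hd, hcd⟩ := WeylAlgebra.isWeylTuple_gen.left_ore
      (K := RationalFunctions l k) WeylAlgebra.adjoin_gen a b (by rintro rfl; simp at hb)
    exact ⟨_, ⟨c, rfl⟩, _, ⟨d, rfl⟩, (map_ne_zero_iff f hf).mpr hd,
      by rw [← map_mul, ← map_mul, hcd]⟩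
  have hpoly : ∀ p ∈ Algebra.adjoin k (Set.range t),
      ∃ P : MvPolynomial (Fin l) k, (MvPolynomial.aeval t' P : D) = p := by
    intro p hp
    obtain ⟨z, hz, rfl⟩ := exists_coe_eq_of_mem_adjoin (t := t') hp
    rw [Algebra.adjoin_range_eq_range_aeval] at hz
    obtain ⟨P, rfl⟩ := hz
    exact ⟨P, rfl⟩
  have hweyl : weylAdjoin k w t ≤ (f.restrictScalars k).range := by
    refine Algebra.adjoin_le ?_
    rintro x (⟨i, rfl⟩ | ⟨p, hp, q, hq, rfl⟩)
    · exact ⟨WeylAlgebra.gen i, WeylAlgebra.lift_gen h.weyl i⟩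
    · obtain ⟨P, rfl⟩ := hpoly p hp
      obtain ⟨Q, rfl⟩ := hpoly q hq
      refine ⟨algebraMap (RationalFunctions l k) _ (algebraMap _ _ P * (algebraMap _ _ Q)⁻¹), ?_⟩
      change f _ = _
      rw [f.commutes, map_mul, map_inv₀, halg, halg, hκ, hκ]
  -- The left fractions of the image of the Weyl algebra form a division subring containing the
  -- scalars and the `e j`.
  have hfrac : ∀ d : D, d ∈ Subring.leftFractions _ hS := by
    refine hgen _ (fun a => ?_) fun j => ?_
    · refine ⟨algebraMap k D a, ⟨algebraMap k _ a, ?_⟩, 1, one_mem _, one_ne_zero, one_mul _⟩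
      exact (f.restrictScalars k).commutes a
    · obtain ⟨p, hp, q, hq, hq0, he⟩ := h.exists_frac j
      exact ⟨p, hweyl hp, q, hweyl hq, hq0, he⟩
  refine ⟨⟨f.restrictScalars k, hf, fun d => ?_⟩, fun d => ?_⟩
  · obtain ⟨_, ⟨a, rfl⟩, _, ⟨b, rfl⟩, hb, he⟩ := hfrac d
    exact ⟨a, b, by rintro rfl; simp at hb, (eq_inv_mul_iff_mul_eq₀ hb).mpr he⟩
  · have hrange : ∀ a, f a ∈ Algebra.adjoin k (Set.range w ∪ (Subalgebra.center k D : Set D)) := by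
      intro a
      have ha : a ∈ Algebra.adjoin (RationalFunctions l k)
          (Set.range (WeylAlgebra.gen : Fin n ⊕ Fin n → WeylAlgebraRat n l k)) :=
        WeylAlgebra.mem_adjoin_gen a
      induction ha using Algebra.adjoin_induction with
      | mem x hx =>
        obtain ⟨i, rfl⟩ := hx
        rw [WeylAlgebra.lift_gen]
        exact Algebra.subset_adjoin (Or.inl ⟨i, rfl⟩)
      | algebraMap c =>
        rw [f.commutes, halg]
        exact Algebra.subset_adjoin (Or.inr (κ c).2)
      | add x y _ _ hx hy => rw [map_add]; exact add_mem hx hy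
      | mul x y _ _ hx hy => rw [map_mul]; exact mul_mem hx hy
    obtain ⟨_, ⟨a, rfl⟩, _, ⟨b, rfl⟩, hb, he⟩ := hfrac d
    exact ⟨_, hrange a, _, hrange b, hb, he⟩

/-- The generators of a Weyl field form a Weyl presentation. -/
theorem of_isSkewFieldOfFractions (f : WeylAlgebraRat n l k →ₐ[k] D)
    (hf : IsSkewFieldOfFractions (f : WeylAlgebraRat n l k →+* D))
    (htr : Algebra.trdeg k (Subalgebra.center k D) = (l : Cardinal)) (e : ι → D)
    (c : κ → Subalgebra.center k D) :
    IsWeylPresentation k (fun i => f (WeylAlgebra.gen i))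
      (fun i => f (algebraMap (RationalFunctions l k) _
        (algebraMap (MvPolynomial (Fin l) k) _ (MvPolynomial.X i)))) e fun i => (c i : D) := by
  have hcentral : ∀ a : RationalFunctions l k,
      f (algebraMap (RationalFunctions l k) _ a) ∈ Subalgebra.center k D := by
    intro a
    rw [Subalgebra.mem_center_iff]
    have hcomm : ∀ b, Commute (f (algebraMap (RationalFunctions l k) _ a)) (f b) := by
      intro b
      rw [Commute, SemiconjBy, ← map_mul, ← map_mul, Algebra.commutes]
    intro d
    obtain ⟨b, b', -, rfl⟩ := hf.exists_frac d
    exact (((hcomm b').inv_right₀).mul_right (hcomm b)).eq.symm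
  let g : RationalFunctions l k →ₐ[k] Subalgebra.center k D :=
    (f.comp (IsScalarTower.toAlgHom k (RationalFunctions l k) _)).codRestrict _ hcentral
  let t : Fin l → Subalgebra.center k D := fun i =>
    g (algebraMap (MvPolynomial (Fin l) k) _ (MvPolynomial.X i))
  have haeval : ∀ p : MvPolynomial (Fin l) k, MvPolynomial.aeval t p = g (algebraMap _ _ p) := by
    intro p
    have : MvPolynomial.aeval t = g.comp (IsScalarTower.toAlgHom k (MvPolynomial (Fin l) k)
        (RationalFunctions l k)) := by
      refine MvPolynomial.algHom_ext fun i => ?_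
      rw [MvPolynomial.aeval_X]
      rfl
    rw [this]
    rfl
  have ht : AlgebraicIndependent k t := by
    rw [algebraicIndependent_iff_injective_aeval]
    intro p q hpq
    rw [haeval, haeval] at hpq
    exact IsFractionRing.injective (MvPolynomial (Fin l) k) (RationalFunctions l k)
      (g.toRingHom.injective hpq)
  -- The count of transcendence degrees makes all of the centre algebraic over `t`, so the centre of
  -- a Weyl field need not be computed.
  have htb : IsTranscendenceBasis k t := by
    refine ht.isTranscendenceBasis_of_lift_trdeg_le_of_finite ?_
    rw [htr]
    simp
  have hmemPoly : ∀ p : MvPolynomial (Fin l) k,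
      (g (algebraMap _ _ p) : D) ∈ Algebra.adjoin k (Set.range fun i => (t i : D)) := by
    intro p
    refine coe_mem_adjoin ?_
    rw [Algebra.adjoin_range_eq_range_aeval, ← haeval]
    exact ⟨p, rfl⟩
  have hmem : ∀ a, f a ∈ weylAdjoin k (fun i => f (WeylAlgebra.gen i)) fun i => (t i : D) := by
    intro a
    have ha : a ∈ Algebra.adjoin (RationalFunctions l k)
        (Set.range (WeylAlgebra.gen : Fin n ⊕ Fin n → WeylAlgebraRat n l k)) :=
      WeylAlgebra.mem_adjoin_gen a
    induction ha using Algebra.adjoin_induction with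
    | mem x hx =>
      obtain ⟨i, rfl⟩ := hx
      exact Algebra.subset_adjoin (Or.inl ⟨i, rfl⟩)
    | algebraMap c =>
      obtain ⟨p, q, -, rfl⟩ := IsFractionRing.div_surjective (A := MvPolynomial (Fin l) k) c
      refine Algebra.subset_adjoin (Or.inr ⟨_, hmemPoly p, _, hmemPoly q, ?_⟩)
      have h : ((Subalgebra.center k D).val.comp g) (algebraMap _ _ p / algebraMap _ _ q) =
          ((Subalgebra.center k D).val.comp g) (algebraMap _ _ p) *
            (((Subalgebra.center k D).val.comp g) (algebraMap _ _ q))⁻¹ := by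
        rw [div_eq_mul_inv, map_mul, map_inv₀]
      exact h
    | add x y _ _ hx hy => rw [map_add]; exact add_mem hx hy
    | mul x y _ _ hx hy => rw [map_mul]; exact mul_mem hx hy
  refine ⟨⟨fun i j => ?_, fun i j => ?_, fun i j => ?_⟩, fun i j => ?_, fun i => ?_, fun j => ?_⟩
  · rw [← map_mul, ← map_mul, WeylAlgebra.isWeylTuple_gen.xx]
  · rw [← map_mul, ← map_mul, WeylAlgebra.isWeylTuple_gen.yy]
  · rw [← map_mul, ← map_mul, WeylAlgebra.isWeylTuple_gen.yx, map_add]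
    split_ifs <;> simp
  · exact (Subalgebra.mem_center_iff.mp (hcentral _) (e j)).symm
  · exact (isAlgebraic_center_iff t (c i)).mp (htb.isAlgebraic.isAlgebraic (c i))
  · obtain ⟨a, b, hb, he⟩ := hf.exists_frac (e j)
    have hb0 : f b ≠ 0 := (map_ne_zero_iff f hf.injective).mpr hb
    exact ⟨f a, hmem a, f b, hmem b, hb0, ((eq_inv_mul_iff_mul_eq₀ hb0).mp he)⟩

end

/-! ### Spreading out of a presentation -/

section

open ScalarMap

variable {R : Type v} [Ring R] {k₀ : Type u} [Field k₀]
  {D : ScalarMap k₀ → Type*} [∀ φ, DivisionRing (D φ)] [∀ φ, Algebra φ.k (D φ)]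
  {ρ : HomFamily R D} {D₀ : Type*} [DivisionRing D₀] [Algebra k₀ D₀] {ρ₀ : BaseChangeHom R k₀ D₀}
  {σ : D₀ → ∀ φ, D φ}

/-- Membership is witnessed by a finite expression, whose finitely many operations `σ` eventually
respects. -/
lemma eventually_mem_adjoin (hσ : IsSpreading ρ ρ₀ σ) {T : Set D₀} {T' : ∀ φ, Set (D φ)}
    (hT : ∀ d ∈ T, ∀ᶠ φ in generic k₀, σ d φ ∈ Algebra.adjoin φ.k (T' φ)) {d : D₀}
    (hd : d ∈ Algebra.adjoin k₀ T) :
    ∀ᶠ φ in generic k₀, σ d φ ∈ Algebra.adjoin φ.k (T' φ) := by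
  induction hd using Algebra.adjoin_induction with
  | mem x hx => exact hT x hx
  | algebraMap c =>
    filter_upwards [hσ.map_algebraMap c] with φ h
    rw [h]
    exact Subalgebra.algebraMap_mem _ _
  | add x y _ _ hx hy =>
    filter_upwards [hx, hy, hσ.add x y] with φ h₁ h₂ h
    rw [h]
    exact add_mem h₁ h₂
  | mul x y _ _ hx hy =>
    filter_upwards [hx, hy, hσ.mul x y] with φ h₁ h₂ h
    rw [h]
    exact mul_mem h₁ h₂

lemma eventually_mem_adjoin_range (hσ : IsSpreading ρ ρ₀ σ) {l : ℕ} {t : Fin l → D₀} {d : D₀}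
    (hd : d ∈ Algebra.adjoin k₀ (Set.range t)) :
    ∀ᶠ φ in generic k₀, σ d φ ∈ Algebra.adjoin φ.k (Set.range fun i => σ (t i) φ) := by
  refine eventually_mem_adjoin hσ ?_ hd
  rintro _ ⟨i, rfl⟩
  exact Filter.Eventually.of_forall fun φ => Algebra.subset_adjoin ⟨i, rfl⟩

lemma eventually_mem_weylAdjoin (hσ : IsSpreading ρ ρ₀ σ) {n l : ℕ} {w : Fin n ⊕ Fin n → D₀}
    {t : Fin l → D₀} {d : D₀} (hd : d ∈ weylAdjoin k₀ w t) :
    ∀ᶠ φ in generic k₀, σ d φ ∈ weylAdjoin φ.k (fun i => σ (w i) φ) fun i => σ (t i) φ := by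
  refine eventually_mem_adjoin hσ ?_ hd
  rintro _ (⟨i, rfl⟩ | ⟨p, hp, q, hq, rfl⟩)
  · exact Filter.Eventually.of_forall fun φ => Algebra.subset_adjoin (Or.inl ⟨i, rfl⟩)
  · filter_upwards [eventually_mem_adjoin_range hσ hp, eventually_mem_adjoin_range hσ hq,
      hσ.mul p q⁻¹, hσ.inv q] with φ h₁ h₂ h₃ h₄
    rw [h₃, h₄]
    exact Algebra.subset_adjoin (Or.inr ⟨_, h₁, _, h₂, rfl⟩)

/-- A Weyl presentation of `Frac A_{k₀}` specializes to Weyl presentations at almost all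
specializations of the scalars. -/
theorem eventually_isWeylPresentation (hσ : IsSpreading ρ ρ₀ σ) {n l : ℕ} {ι κ : Type*} [Finite ι]
    [Finite κ] {w : Fin n ⊕ Fin n → D₀} {t : Fin l → D₀} {e : ι → D₀} {c : κ → D₀}
    (h : IsWeylPresentation k₀ w t e c) :
    ∀ᶠ φ in generic k₀, IsWeylPresentation φ.k (fun i => σ (w i) φ) (fun i => σ (t i) φ)
      (fun j => σ (e j) φ) fun i => σ (c i) φ := by
  have hcomm : ∀ a b : D₀, a * b = b * a →
      ∀ᶠ φ in generic k₀, σ a φ * σ b φ = σ b φ * σ a φ := by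
    intro a b hab
    filter_upwards [hσ.mul a b, hσ.mul b a] with φ h₁ h₂
    rw [← h₁, ← h₂, hab]
  have hxx := Filter.eventually_all.mpr fun i => Filter.eventually_all.mpr fun j =>
    hcomm _ _ (h.weyl.xx i j)
  have hyy := Filter.eventually_all.mpr fun i => Filter.eventually_all.mpr fun j =>
    hcomm _ _ (h.weyl.yy i j)
  have hyx : ∀ᶠ φ in generic k₀, ∀ i j, σ (w (Sum.inr i)) φ * σ (w (Sum.inl j)) φ =
      σ (w (Sum.inl j)) φ * σ (w (Sum.inr i)) φ + if i = j then 1 else 0 := by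
    refine Filter.eventually_all.mpr fun i => Filter.eventually_all.mpr fun j => ?_
    have h1 := hσ.mul (w (Sum.inr i)) (w (Sum.inl j))
    rw [h.weyl.yx] at h1
    filter_upwards [h1, hσ.mul (w (Sum.inl j)) (w (Sum.inr i)),
      hσ.add (w (Sum.inl j) * w (Sum.inr i)) (if i = j then 1 else 0), hσ.one, hσ.zero]
      with φ h₁ h₂ h₃ h₄ h₅
    rw [← h₁, h₃, h₂]
    split_ifs
    · rw [h₄]
    · rw [h₅]
  have htc := Filter.eventually_all.mpr fun i => Filter.eventually_all.mpr fun j =>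
    hcomm _ _ (h.comm_gen i j)
  have halg : ∀ᶠ φ in generic k₀, ∀ i, ∃ (m : ℕ) (f : ℕ → D φ),
      (∀ j, f j ∈ Algebra.adjoin φ.k (Set.range fun i => σ (t i) φ)) ∧
      (∃ j ∈ Finset.range m, f j ≠ 0) ∧ ∑ j ∈ Finset.range m, f j * σ (c i) φ ^ j = 0 := by
    refine Filter.eventually_all.mpr fun i => ?_
    obtain ⟨m, f, hf, ⟨j, hj, hj0⟩, hsum⟩ := h.algebraic i
    have hs := hσ.sum (Finset.range m) fun j => f j * c i ^ j
    rw [hsum] at hs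
    have hmem := (Filter.eventually_all_finset (Finset.range m)).mpr fun j _ =>
      eventually_mem_adjoin_range hσ (hf j)
    have hterm := (Filter.eventually_all_finset (Finset.range m)).mpr fun j _ =>
      (hσ.mul (f j) (c i ^ j)).and (hσ.pow (c i) j)
    filter_upwards [hs, hmem, hterm, hσ.zero, hσ.ne_zero _ hj0] with φ h₁ h₂ h₃ h₄ h₅
    -- Coefficients beyond `m` are replaced by `0`, since infinitely many eventual memberships need
    -- not hold at one `φ`.
    have hif : ∀ j ∈ Finset.range m,
        (if j ∈ Finset.range m then σ (f j) φ else 0) = σ (f j) φ := fun j hj => if_pos hj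
    refine ⟨m, fun j => if j ∈ Finset.range m then σ (f j) φ else 0, fun j => ?_,
      ⟨j, hj, (hif j hj).trans_ne h₅⟩, ?_⟩
    · change (if j ∈ Finset.range m then σ (f j) φ else 0) ∈ _
      split_ifs with hjm
      · exact h₂ j hjm
      · exact zero_mem _
    · refine Eq.trans ?_ (h₁.symm.trans h₄)
      refine Finset.sum_congr rfl fun j hj => ?_
      rw [(h₃ j hj).1, (h₃ j hj).2]
      exact congrArg (· * _) (hif j hj)
  have hfrac : ∀ᶠ φ in generic k₀, ∀ j,
      ∃ p ∈ weylAdjoin φ.k (fun i => σ (w i) φ) (fun i => σ (t i) φ),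
      ∃ q ∈ weylAdjoin φ.k (fun i => σ (w i) φ) (fun i => σ (t i) φ),
        q ≠ 0 ∧ q * σ (e j) φ = p := by
    refine Filter.eventually_all.mpr fun j => ?_
    obtain ⟨p, hp, q, hq, hq0, he⟩ := h.exists_frac j
    have hm := hσ.mul q (e j)
    rw [he] at hm
    filter_upwards [eventually_mem_weylAdjoin hσ hp, eventually_mem_weylAdjoin hσ hq,
      hσ.ne_zero q hq0, hm] with φ h₁ h₂ h₃ h₄
    exact ⟨_, h₁, _, h₂, h₃, h₄.symm⟩
  filter_upwards [hxx, hyy, hyx, htc, halg, hfrac] with φ h₁ h₂ h₃ h₄ h₅ h₆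
  exact ⟨⟨h₁, h₂, h₃⟩, h₄, h₅, h₆⟩

end

end IsWeylPresentation

/-! ## The variety of partial homomorphisms -/

/-- A form of the Nullstellensatz: a nonzero finitely generated commutative algebra over a field has
points in every algebraically closed extension field. -/
theorem nonempty_algHom_of_finiteType {K : Type*} [Field K] (C : Type*) [CommRing C] [Nontrivial C]
    [Algebra K C] [Algebra.FiniteType K C] (k : Type*) [Field k] [IsAlgClosed k] [Algebra K k] :
    Nonempty (C →ₐ[K] k) := by
  obtain ⟨M, hM⟩ := Ideal.exists_maximal C
  let : Field (C ⧸ M) := Ideal.Quotient.field M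
  have : Algebra.FiniteType K (C ⧸ M) :=
    Algebra.FiniteType.of_surjective (Ideal.Quotient.mkₐ K M) (Ideal.Quotient.mkₐ_surjective K M)
  have : Module.Finite K (C ⧸ M) := finite_of_finite_type_of_isJacobsonRing K (C ⧸ M)
  exact ⟨(IsAlgClosed.lift (R := K) (S := C ⧸ M) (M := k)).comp (Ideal.Quotient.mkₐ K M)⟩

namespace ScalarMap

/-- The variable `T_i` stands for the value of the map at the `i`-th element of `s`. -/
lemma eval_eq_specialize {k₀ : Type u} {R : Type v} [Ring R] {s : Finset k₀} {N : ℕ} (e : Fin N ≃ s)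
    (f : k₀ →₀ R) (hf : f.support ⊆ s) (φ : ScalarMap k₀) :
    specialize R (fun i => φ.val (e i)) (∑ i, MvPolynomial.X i ⊗ₜ f (e i)) = φ.eval f := by
  rw [map_sum, eval, Finsupp.sum_of_support_subset f hf _ fun _ _ => TensorProduct.tmul_zero _ _,
    ← Finset.sum_coe_sort s, ← e.sum_comp fun c : s => φ.val c ⊗ₜ[ℤ] f c]
  refine Finset.sum_congr rfl fun i _ => ?_
  simp [specialize]

variable {k₀ : Type u} [Field k₀]

/-- By the Nullstellensatz, a field of characteristic zero has partial homomorphisms to all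
algebraically closed fields of characteristic zero. -/
theorem exists_mem_partialHoms [CharZero k₀] (s : Finset k₀) (k : Type u) [Field k]
    [IsAlgClosed k] [CharZero k] : ∃ val : k₀ → k, (⟨k, val⟩ : ScalarMap k₀) ∈ partialHoms s := by
  classical
  -- With the inverses adjoined, nonzero elements of `s` are units in `B`, and no homomorphism to
  -- `k` kills them.
  let B : Subalgebra ℚ k₀ := Algebra.adjoin ℚ ↑(s ∪ s.image (·⁻¹))
  have hsB : ∀ a ∈ s, a ∈ B := fun a ha =>
    Algebra.subset_adjoin (Finset.mem_coe.mpr (Finset.mem_union_left _ ha))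
  have hsB' : ∀ a ∈ s, a⁻¹ ∈ B := fun a ha =>
    Algebra.subset_adjoin (Finset.mem_coe.mpr (Finset.mem_union_right _
      (Finset.mem_image_of_mem _ ha)))
  have : Algebra.FiniteType ℚ B := B.fg_iff_finiteType.mp (Subalgebra.fg_adjoin_finset _)
  obtain ⟨ψ⟩ : Nonempty (B →ₐ[ℚ] k) := nonempty_algHom_of_finiteType B k
  have hval : ∀ a (ha : a ∈ B), (if h : a ∈ B then ψ ⟨a, h⟩ else 0) = ψ ⟨a, ha⟩ :=
    fun a ha => dif_pos ha
  refine ⟨fun a => if h : a ∈ B then ψ ⟨a, h⟩ else 0, fun a ha b hb hab => ?_,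
    fun a ha b hb hab => ?_, fun h1 => ?_, fun a ha ha0 => ?_⟩
  · dsimp only
    rw [hval _ (hsB _ ha), hval _ (hsB _ hb), hval _ (hsB _ hab), ← map_add]
    rfl
  · dsimp only
    rw [hval _ (hsB _ ha), hval _ (hsB _ hb), hval _ (hsB _ hab), ← map_mul]
    rfl
  · dsimp only
    rw [hval _ (hsB _ h1)]
    exact map_one ψ
  · dsimp only
    rw [hval _ (hsB _ ha)]
    refine left_ne_zero_of_mul_eq_one (b := ψ ⟨a⁻¹, hsB' _ ha⟩) ?_
    rw [← map_mul, ← map_one ψ]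
    exact congrArg ψ (Subtype.ext (mul_inv_cancel₀ ha0))

/-- The partial homomorphisms on a finite set form a locally closed variety over the integers. -/
theorem exists_integralLocallyClosed (s : Finset k₀) {N : ℕ} (e : Fin N ≃ s) :
    ∃ F G : Finset (MvPolynomial (Fin N) ℤ), ∀ (k : Type u) [Field k] [IsAlgClosed k] [CharZero k]
      (val : k₀ → k), (fun i => val (e i)) ∈ integralLocallyClosed F G k ↔
        (⟨k, val⟩ : ScalarMap k₀) ∈ partialHoms s := by
  classical
  -- Indices without a relation contribute the zero polynomial. `G` is a single product because all
  -- nonzero elements of `s` must stay nonzero at once.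
  refine ⟨(Finset.univ.image fun p : Fin N × Fin N × Fin N =>
      if (e p.1 + e p.2.1 : k₀) = e p.2.2 then
        MvPolynomial.X p.1 + MvPolynomial.X p.2.1 - MvPolynomial.X p.2.2 else 0) ∪
    (Finset.univ.image fun p : Fin N × Fin N × Fin N =>
      if (e p.1 * e p.2.1 : k₀) = e p.2.2 then
        MvPolynomial.X p.1 * MvPolynomial.X p.2.1 - MvPolynomial.X p.2.2 else 0) ∪
    (Finset.univ.image fun i => if (e i : k₀) = 1 then MvPolynomial.X i - 1 else 0),
    {∏ i with (e i : k₀) ≠ 0, MvPolynomial.X i}, fun k _ _ _ val => ?_⟩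
  have key : ∀ {P : k₀ → Prop}, (∀ a ∈ s, P a) ↔ ∀ i, P (e i) := fun {P} =>
    ⟨fun h i => h _ (e i).2, fun h a ha => by simpa using h (e.symm ⟨a, ha⟩)⟩
  have hite : ∀ {c : Prop} [Decidable c] {f : MvPolynomial (Fin N) ℤ},
      MvPolynomial.aeval (fun i => val (e i)) (if c then f else 0) = 0 ↔
        (c → MvPolynomial.aeval (fun i => val (e i)) f = 0) := by
    intro c _ f
    split_ifs with hc <;> simp [hc]
  simp only [integralLocallyClosed, Set.mem_ofPred_eq, partialHoms, Finset.forall_mem_union,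
    Finset.forall_mem_image, Finset.mem_univ, forall_const, Finset.mem_singleton, exists_eq_left,
    hite, Prod.forall, map_sub, map_add, map_mul, MvPolynomial.aeval_X, map_one, map_prod,
    Finset.prod_ne_zero_iff, Finset.mem_filter, true_and, sub_eq_zero, and_assoc]
  refine and_congr ?_ (and_congr ?_ (and_congr ?_ ?_))
  · rw [key]
    refine forall_congr' fun i => ?_
    rw [key]
    refine forall_congr' fun j => ⟨fun h hs => ?_, fun h m hm => ?_⟩
    · simpa using (h (e.symm ⟨_, hs⟩) (by simp)).symm
    · rw [← hm, h (hm ▸ (e m).2)]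
  · rw [key]
    refine forall_congr' fun i => ?_
    rw [key]
    refine forall_congr' fun j => ⟨fun h hs => ?_, fun h m hm => ?_⟩
    · simpa using (h (e.symm ⟨_, hs⟩) (by simp)).symm
    · rw [← hm, h (hm ▸ (e m).2)]
  · refine ⟨fun h hs => ?_, fun h i hi => ?_⟩
    · simpa using @h (e.symm ⟨_, hs⟩) (by simp)
    · rw [hi, h (hi ▸ (e i).2)]
  · rw [key]

end ScalarMap

/-! ## Invariants of a compatible family -/

namespace IsIntegralFiltration

variable {R : Type v} [Ring R] {F : ℕ → Submodule ℤ R}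

/-- By injectivity, `k ⊗ A_1` is its own image in `A_k`, so its dimension is the rank over `ℤ`,
whatever `k` is. -/
lemma finrank_baseChange (hF : IsIntegralFiltration.{u} R F) (k : Type u) [Field k]
    [IsAlgClosed k] : Module.finrank k ((F 1).baseChange k) = Module.finrank ℤ (F 1) := by
  have := hF.free 1 le_rfl
  have := hF.finite 1 le_rfl
  change Module.finrank k (LinearMap.range ((F 1).subtype.baseChange k)) = _
  rw [← (LinearEquiv.ofInjective ((F 1).subtype.baseChange k)
      (hF.baseChange_injective k 1)).finrank_eq, Module.finrank_baseChange]

/-- The ring of an integral filtration is finitely generated. -/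
lemma exists_finset_adjoin_eq_top (hF : IsIntegralFiltration.{u} R F) :
    ∃ S : Finset R, Algebra.adjoin ℤ (S : Set R) = ⊤ := by
  obtain ⟨S, hS⟩ := Module.Finite.iff_fg.mp (hF.finite 1 le_rfl)
  refine ⟨S, top_unique fun r _ => ?_⟩
  obtain ⟨i, hi⟩ := hF.exhaustive r
  have hle : F 1 ≤ Subalgebra.toSubmodule (Algebra.adjoin ℤ (S : Set R)) := by
    rw [← hS]
    exact Algebra.span_le_adjoin ℤ _
  have h1 : r ∈ F (i + 1) := hF.mono (Nat.le_succ i) hi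
  rw [hF.pow (i + 1) (by omega)] at h1
  refine Submodule.pow_induction_on_left' (F 1)
    (C := fun _ x _ => x ∈ Algebra.adjoin ℤ (S : Set R)) (fun c => Subalgebra.algebraMap_mem _ c)
    (fun x y i _ _ hx hy => add_mem hx hy) (fun m hm i x _ hx => mul_mem (hle hm) hx) h1

end IsIntegralFiltration

namespace IsZCompatible

variable {R : Type v} [Ring R] (hR : IsZCompatible.{u, v} R)

/-- The skew field of fractions of `A_k`. -/
def FracAt (k : Type u) [Field k] [IsAlgClosed k] : Type (max u v) :=
  have := hR.isOreDomain k
  SkewFrac (BaseChangeRing k R)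

section

variable (k : Type u) [Field k] [IsAlgClosed k]

instance : DivisionRing (hR.FracAt k) :=
  have := hR.isOreDomain k
  inferInstanceAs (DivisionRing (SkewFrac (BaseChangeRing k R)))

instance : Algebra k (hR.FracAt k) :=
  have := hR.isOreDomain k
  inferInstanceAs (Algebra k (SkewFrac (BaseChangeRing k R)))

/-- The embedding of `A_k` into its skew field of fractions. -/
def ofAt : BaseChangeHom R k (hR.FracAt k) :=
  have := hR.isOreDomain k
  { SkewFrac.of (BaseChangeRing k R) with commutes' := fun _ => rfl }

lemma ofAt_injective : Function.Injective (hR.ofAt k) :=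
  have := hR.isOreDomain k
  SkewFrac.of_injective

end

end IsZCompatible

lemma trdeg_fractionRing (k : Type*) [Field k] (Z : Type*) [CommRing Z] [IsDomain Z] [Algebra k Z] :
    Algebra.trdeg k (FractionRing Z) = Algebra.trdeg k Z := by
  have : Algebra.IsAlgebraic Z (FractionRing Z) :=
    IsFractionRing.comap_isAlgebraic_iff (K := FractionRing Z).mpr inferInstance
  rw [← trdeg_add_eq k Z (A := FractionRing Z), trdeg_eq_zero (R := Z), add_zero]

/-! ### Generation, transcendence degree and centre of the skew fields -/

namespace IsZCompatible

variable {R : Type v} [Ring R] (hR : IsZCompatible.{u, v} R)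

section

variable (k : Type u) [Field k] [IsAlgClosed k]

/-- A division subring of `Frac A_k` is everything if it contains the scalars and generators of
the ring `A_ℤ`. -/
lemma mem_of_adjoin_eq_top {S : Set R} (hS : Algebra.adjoin ℤ S = ⊤) (L : Subfield (hR.FracAt k))
    (hk : ∀ a : k, algebraMap k (hR.FracAt k) a ∈ L) (hL : ∀ r ∈ S, hR.ofAt k (1 ⊗ₜ r) ∈ L)
    (d : hR.FracAt k) : d ∈ L := by
  have hconst : ∀ r : R, hR.ofAt k (1 ⊗ₜ r) ∈ L := by
    intro r
    have hr : r ∈ Algebra.adjoin ℤ S := hS ▸ Algebra.mem_top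
    induction hr using Algebra.adjoin_induction with
    | mem r hr => exact hL r hr
    | algebraMap m =>
      have h : (1 : k) ⊗ₜ[ℤ] algebraMap ℤ R m = algebraMap ℤ (BaseChangeRing k R) m :=
        (Algebra.TensorProduct.includeRight : R →ₐ[ℤ] BaseChangeRing k R).commutes m
      rw [h, eq_intCast, map_intCast]
      exact intCast_mem L m
    | add x y _ _ hx hy =>
      rw [TensorProduct.tmul_add, map_add]
      exact add_mem hx hy
    | mul x y _ _ hx hy =>
      rw [← one_mul (1 : k), ← Algebra.TensorProduct.tmul_mul_tmul, map_mul]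
      exact mul_mem hx hy
  have hall : ∀ x : BaseChangeRing k R, hR.ofAt k x ∈ L := by
    intro x
    induction x using TensorProduct.induction_on with
    | zero => rw [map_zero]; exact L.zero_mem
    | tmul c r =>
      have h : c ⊗ₜ[ℤ] r = algebraMap k (BaseChangeRing k R) c * 1 ⊗ₜ r := by
        rw [Algebra.TensorProduct.algebraMap_apply, Algebra.TensorProduct.tmul_mul_tmul, mul_one,
          one_mul]
        rfl
      rw [h, map_mul, AlgHom.commutes]
      exact mul_mem (hk c) (hconst r)
    | add x y hx hy => rw [map_add]; exact add_mem hx hy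
  have := hR.isOreDomain k
  exact SkewFrac.mem_of_forall_of_mem L hall d

lemma ofAt_mem_center {x : BaseChangeRing k R} (hx : x ∈ Subalgebra.center k (BaseChangeRing k R)) :
    hR.ofAt k x ∈ Subalgebra.center k (hR.FracAt k) := by
  rw [Subalgebra.mem_center_iff]
  intro d
  have := hR.isOreDomain k
  refine (SkewFrac.mem_of_forall_of_mem (divisionCentralizer (hR.ofAt k x)) (fun a => ?_) d).symm
  change hR.ofAt k x * hR.ofAt k a = hR.ofAt k a * hR.ofAt k x
  rw [← map_mul, ← map_mul, Subalgebra.mem_center_iff.mp hx a]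

end

/-- The Gelfand–Kirillov transcendence degree does not depend on the field. -/
lemma exists_gkTdeg_eq : ∃ d : EReal, ∀ (k : Type u) [Field k] [IsAlgClosed k],
    gkTdeg k (hR.FracAt k) = d := by
  obtain ⟨F, hF, h | h⟩ := hR.exists_filtration
  · refine ⟨(Module.finrank ℤ (F 1) : ℕ), fun k _ _ => ?_⟩
    rw [← hF.finrank_baseChange k]
    exact h k
  · refine ⟨((Module.finrank ℤ (F 1) : ℕ) : EReal) - 1, fun k _ _ => ?_⟩
    have h1 : gkTdeg k (hR.FracAt k) + 1 = _ := h k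
    rw [hF.finrank_baseChange k] at h1
    rw [← h1]
    exact (EReal.add_sub_cancel_right (b := 1)).symm

/-- Central elements of `A_ℤ` that are free polynomial generators of the centre of each `A_k` of
characteristic zero. -/
lemma exists_center_generators : ∃ (s : ℕ) (x : Fin s → R),
    ∀ (k : Type u) [Field k] [IsAlgClosed k] [CharZero k],
      (haveI := hR.isOreDomain k;
        Algebra.trdeg k (FractionRing (Subalgebra.center k (BaseChangeRing k R))) = (s : Cardinal)) ∧
      Algebra.trdeg k (Subalgebra.center k (hR.FracAt k)) = (s : Cardinal) ∧
      ∃ c : Fin s → Subalgebra.center k (hR.FracAt k),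
        (∀ i, (c i : hR.FracAt k) = hR.ofAt k (1 ⊗ₜ x i)) ∧ AlgebraicIndependent k c := by
  obtain ⟨s, x, hx, -⟩ := hR.center_polynomial
  refine ⟨s, x, fun k _ _ _ => ?_⟩
  have := hR.isOreDomain k
  obtain ⟨hxc, hbij⟩ := hx k
  have htr : Algebra.trdeg k (FractionRing (Subalgebra.center k (BaseChangeRing k R))) =
      (s : Cardinal) := by
    rw [trdeg_fractionRing]
    have h := AlgEquiv.lift_trdeg_eq (R := k) (A := MvPolynomial (Fin s) k)
      (A' := Subalgebra.center k (BaseChangeRing k R)) (AlgEquiv.ofBijective _ hbij)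
    rw [MvPolynomial.trdeg_of_isDomain] at h
    simpa using h.symm
  -- This abstract isomorphism need not respect the `x i`, so only the transcendence degree is taken
  -- from it. Independence of their images comes from the embedding of `A_k`.
  obtain ⟨f⟩ := hR.center_skewFrac k
  refine ⟨htr, htr ▸ (f.trdeg_eq), fun i => ⟨_, hR.ofAt_mem_center k (hxc i)⟩, fun i => rfl, ?_⟩
  have hind : AlgebraicIndependent k (fun i =>
    (⟨(1 : k) ⊗ₜ[ℤ] x i, hxc i⟩ : Subalgebra.center k (BaseChangeRing k R))) := hbij.injective
  let g : Subalgebra.center k (BaseChangeRing k R) →ₐ[k] Subalgebra.center k (hR.FracAt k) :=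
    ((hR.ofAt k).comp (Subalgebra.center k (BaseChangeRing k R)).val).codRestrict _
      fun z => hR.ofAt_mem_center k z.2
  exact hind.map' (f := g) fun a b hab =>
    Subtype.ext (hR.ofAt_injective k (congrArg Subtype.val hab))

end IsZCompatible

/-! ### Specialization of Weyl generators -/

namespace IsZCompatible

open ScalarMap

variable {R : Type v} [Ring R] (hR : IsZCompatible.{u, v} R)

/-- Nonzero elements of `A_{k₀}` become units in the reduced product, so the Ore localization maps
there. -/
lemma exists_isSpreading_ofAt (k₀ : Type u) [Field k₀] [IsAlgClosed k₀] :
    ∃ σ : hR.FracAt k₀ → ∀ φ : ScalarMap k₀, hR.FracAt φ.k,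
      IsSpreading (fun φ : ScalarMap k₀ => hR.ofAt φ.k) (hR.ofAt k₀) σ := by
  obtain ⟨F, hF, -⟩ := hR.exists_filtration
  have := hR.isOreDomain k₀
  obtain ⟨Θ, hΘ⟩ := SkewFrac.exists_lift
    (toReduced (fun φ : ScalarMap k₀ => hR.ofAt φ.k)) fun x hx =>
      isUnit_toReduced _ hF (fun φ => hR.ofAt_injective φ.k) hx
  exact exists_isSpreading (D₀ := hR.FracAt k₀) Θ hΘ

/-- If the Gelfand–Kirillov Conjecture holds over one field, then Weyl generators specialize to
Weyl generators at almost all specializations of the scalars. -/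
theorem exists_eventually_isWeylGenerators (k₀ : Type u) [Field k₀] [IsAlgClosed k₀] [CharZero k₀]
    (hGK : haveI := hR.isOreDomain k₀; GelfandKirillovHolds k₀ (BaseChangeRing k₀ R)) :
    ∃ (m : ℕ) (a b : Fin m ⊕ Fin m → k₀ →₀ R), ∀ᶠ φ in generic k₀,
      haveI := hR.isOreDomain φ.k
      GelfandKirillovHolds φ.k (BaseChangeRing φ.k R) ∧ (∀ i, φ.eval (b i) ≠ 0) ∧
        IsWeylGenerators φ.k (BaseChangeRing φ.k R) m fun i =>
          (SkewFrac.of (BaseChangeRing φ.k R) (φ.eval (b i)))⁻¹ *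
            SkewFrac.of (BaseChangeRing φ.k R) (φ.eval (a i)) := by
  have := hR.isOreDomain k₀
  obtain ⟨n, l, hdeg, htr, f, hf⟩ := hGK
  obtain ⟨d, hd⟩ := hR.exists_gkTdeg_eq
  obtain ⟨s, x, hx⟩ := hR.exists_center_generators
  obtain ⟨F, hF, -⟩ := hR.exists_filtration
  obtain ⟨S, hS⟩ := hF.exists_finset_adjoin_eq_top
  obtain rfl : s = l := Nat.cast_injective (R := Cardinal) ((hx k₀).1.symm.trans htr)
  have hd' : d = ((2 * n + s : ℕ) : EReal) := (hd k₀).symm.trans hdeg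
  obtain ⟨-, htr₀, c, hc, -⟩ := hx k₀
  have hpres : IsWeylPresentation (D := hR.FracAt k₀) k₀ _ _ _ _ :=
    IsWeylPresentation.of_isSkewFieldOfFractions f hf htr₀
      (fun r : S => hR.ofAt k₀ (1 ⊗ₜ (r : R))) c
  obtain ⟨σ, hσ⟩ := hR.exists_isSpreading_ofAt k₀
  set w : Fin n ⊕ Fin n → hR.FracAt k₀ := fun i => f (WeylAlgebra.gen i) with hw
  -- The Weyl algebra has `[y, x] = 1`, whereas Weyl generators require `[w_i, w_{m+i}] = 1`; hence
  -- the swap of the two halves.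
  have hfrac : ∀ i, ∃ a b : k₀ →₀ R, tensorSum b ≠ 0 ∧
      w (Sum.swap i) = (hR.ofAt k₀ (tensorSum b))⁻¹ * hR.ofAt k₀ (tensorSum a) := by
    intro i
    obtain ⟨a, b, hb, h⟩ := SkewFrac.exists_eq_inv_mul (A := BaseChangeRing k₀ R) (w (Sum.swap i))
    obtain ⟨a, rfl⟩ := tensorSum_surjective a
    obtain ⟨b, rfl⟩ := tensorSum_surjective b
    exact ⟨a, b, hb, h⟩
  choose a b hb hab using hfrac
  refine ⟨n, a, b, ?_⟩
  have hb' : ∀ᶠ φ in generic k₀, ∀ i, φ.eval (b i) ≠ 0 := by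
    refine Filter.eventually_all.mpr fun i => ?_
    filter_upwards [hσ.map_tensorSum (b i),
      hσ.ne_zero _ ((map_ne_zero_iff _ (hR.ofAt_injective k₀)).mpr (hb i))] with φ h₁ h₂ h₃
    rw [h₁, h₃, map_zero] at h₂
    exact h₂ rfl
  have hw' : ∀ᶠ φ in generic k₀, ∀ i, σ (w (Sum.swap i)) φ =
      (hR.ofAt φ.k (φ.eval (b i)))⁻¹ * hR.ofAt φ.k (φ.eval (a i)) := by
    refine Filter.eventually_all.mpr fun i => ?_
    rw [hab]
    filter_upwards [hσ.mul (hR.ofAt k₀ (tensorSum (b i)))⁻¹ (hR.ofAt k₀ (tensorSum (a i))),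
      hσ.inv (hR.ofAt k₀ (tensorSum (b i))), hσ.map_tensorSum (a i),
      hσ.map_tensorSum (b i)] with φ h₁ h₂ h₃ h₄
    rw [h₁, h₂, h₃, h₄]
  have he' : ∀ᶠ φ in generic k₀, ∀ r : S,
      σ (hR.ofAt k₀ (1 ⊗ₜ (r : R))) φ = hR.ofAt φ.k (1 ⊗ₜ (r : R)) :=
    Filter.eventually_all.mpr fun r => hσ.map_const r
  have hc' : ∀ᶠ φ in generic k₀, ∀ i, σ (c i) φ = hR.ofAt φ.k (1 ⊗ₜ x i) := by
    refine Filter.eventually_all.mpr fun i => ?_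
    rw [hc]
    exact hσ.map_const (x i)
  filter_upwards [hpres.eventually_isWeylPresentation hσ, hb', hw', he', hc'] with φ hφ h₁ h₂ h₃ h₄
  -- The images of the `x i` are independent over the new field as well, by compatibility, and
  -- coincide with the specialized `c i`.
  obtain ⟨htrφ, -, cφ, hcφ, hind⟩ := hx φ.k
  have hcc : (fun i => σ (c i) φ) = fun i => (cφ i : hR.FracAt φ.k) :=
    funext fun i => (h₄ i).trans (hcφ i).symm
  rw [hcc] at hφ
  obtain ⟨hfield, hgen⟩ := hφ.isWeylField hind fun L hk hL d =>
    hR.mem_of_adjoin_eq_top φ.k hS L hk (fun r hr => h₃ ⟨r, hr⟩ ▸ hL ⟨r, hr⟩) d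
  have := hR.isOreDomain φ.k
  refine ⟨⟨n, s, (hd φ.k).trans hd', htrφ, hfield⟩, h₁, ?_⟩
  have hwφ : (fun i => (hR.ofAt φ.k (φ.eval (b i)))⁻¹ * hR.ofAt φ.k (φ.eval (a i))) =
      fun i => σ (w (Sum.swap i)) φ := funext fun i => (h₂ i).symm
  change IsWeylGenerators φ.k (BaseChangeRing φ.k R) n
    (fun i => (hR.ofAt φ.k (φ.eval (b i)))⁻¹ * hR.ofAt φ.k (φ.eval (a i)))
  rw [hwφ]
  have hrange : Set.range (fun i => σ (w (Sum.swap i)) φ) = Set.range fun i => σ (w i) φ :=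
    (Equiv.sumComm (Fin n) (Fin n)).surjective.range_comp fun i => σ (w i) φ
  rw [← hrange] at hgen
  exact ⟨fun i j => hφ.weyl.yy i j, fun i j => hφ.weyl.xx i j,
    fun i j => sub_eq_of_eq_add' (hφ.weyl.yx i j), hgen⟩

end IsZCompatible

end

/-! ### The variety and the dichotomy -/

theorem mainTheorem9 (R : Type v) [Ring R] (hR : IsZCompatible.{u, v} R) :
    ∃ (N : ℕ) (F G : Finset (MvPolynomial (Fin N) ℤ)) (m : ℕ)
      (a b : Fin m ⊕ Fin m → MvPolynomial (Fin N) ℤ ⊗[ℤ] R),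
      ∀ (k : Type u) [Field k] [IsAlgClosed k] [CharZero k],
        haveI : IsOreDomain (k ⊗[ℤ] R) := hR.isOreDomain k
        (GelfandKirillovHolds k (k ⊗[ℤ] R) ↔ (integralLocallyClosed F G k).Nonempty) ∧
        ∀ z ∈ integralLocallyClosed F G k,
          (∀ i, specialize R z (b i) ≠ 0) ∧
          IsWeylGenerators k (k ⊗[ℤ] R) m (fun i =>
            (SkewFrac.of (k ⊗[ℤ] R) (specialize R z (b i)))⁻¹ *
              SkewFrac.of (k ⊗[ℤ] R) (specialize R z (a i))) := by
  classical
  by_cases hex : ∃ (k₀ : Type u) (_ : Field k₀) (_ : IsAlgClosed k₀) (_ : CharZero k₀),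
      haveI := hR.isOreDomain k₀
      GelfandKirillovHolds k₀ (BaseChangeRing k₀ R)
  · obtain ⟨k₀, _, _, _, hGK⟩ := hex
    obtain ⟨m, a, b, h⟩ := hR.exists_eventually_isWeylGenerators k₀ hGK
    obtain ⟨s₁, hs₁⟩ := ScalarMap.eventually_generic_iff.mp h
    -- The supports are added so that all coefficients of the numerators and denominators occur
    -- among the coordinates.
    let s : Finset k₀ := s₁ ∪ Finset.univ.biUnion fun i => (a i).support ∪ (b i).support
    have hs : ∀ i, (a i).support ∪ (b i).support ⊆ s := fun i =>
      (Finset.subset_biUnion_of_mem (fun i => (a i).support ∪ (b i).support)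
        (Finset.mem_univ i)).trans Finset.subset_union_right
    let e : Fin s.card ≃ s := s.equivFin.symm
    obtain ⟨F, G, hFG⟩ := ScalarMap.exists_integralLocallyClosed s e
    refine ⟨s.card, F, G, m, fun i => ∑ j, MvPolynomial.X j ⊗ₜ a i (e j),
      fun i => ∑ j, MvPolynomial.X j ⊗ₜ b i (e j), fun k _ _ _ => ?_⟩
    have := hR.isOreDomain k
    have key : ∀ z ∈ integralLocallyClosed F G k, GelfandKirillovHolds k (k ⊗[ℤ] R) ∧
        (∀ i, specialize R z (∑ j, MvPolynomial.X j ⊗ₜ b i (e j)) ≠ 0) ∧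
        IsWeylGenerators k (k ⊗[ℤ] R) m (fun i =>
          (SkewFrac.of (k ⊗[ℤ] R) (specialize R z (∑ j, MvPolynomial.X j ⊗ₜ b i (e j))))⁻¹ *
            SkewFrac.of (k ⊗[ℤ] R)
              (specialize R z (∑ j, MvPolynomial.X j ⊗ₜ a i (e j)))) := by
      intro z hz
      -- A point prescribes a map only on `s`. It is extended by zero, which is harmless as only
      -- values on `s` enter.
      obtain ⟨val, rfl⟩ : ∃ val : k₀ → k, (fun j => val (e j)) = z :=
        ⟨Function.extend (fun j => (e j : k₀)) z 0, funext fun j =>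
          (Subtype.val_injective.comp e.injective).extend_apply z 0 j⟩
      have hφ := hs₁ ⟨k, val⟩ (ScalarMap.partialHoms_anti Finset.subset_union_left
        ((hFG k val).mp hz))
      have ha : ∀ i, specialize R (fun j => val (e j)) (∑ j, MvPolynomial.X j ⊗ₜ a i (e j)) = _ :=
        fun i => ScalarMap.eval_eq_specialize e (a i) (Finset.subset_union_left.trans (hs i))
          ⟨k, val⟩
      have hb : ∀ i, specialize R (fun j => val (e j)) (∑ j, MvPolynomial.X j ⊗ₜ b i (e j)) = _ :=
        fun i => ScalarMap.eval_eq_specialize e (b i) (Finset.subset_union_right.trans (hs i))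
          ⟨k, val⟩
      simp only [ha, hb]
      exact hφ
    -- The variety has points over every `k`, so the forward implication ignores its premise.
    refine ⟨⟨fun _ => ?_, fun ⟨z, hz⟩ => (key z hz).1⟩, fun z hz => (key z hz).2⟩
    obtain ⟨val, hval⟩ := ScalarMap.exists_mem_partialHoms s k
    exact ⟨_, (hFG k val).mpr hval⟩
  -- With `G` empty, no `g` can be nonzero, so the variety is empty.
  · refine ⟨0, ∅, ∅, 0, 0, 0, fun k _ _ _ => ?_⟩
    have hempty : integralLocallyClosed (∅ : Finset (MvPolynomial (Fin 0) ℤ)) ∅ k = ∅ :=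
      Set.eq_empty_of_forall_notMem fun z hz => by
        obtain ⟨g, hg, -⟩ := hz.2
        exact Finset.notMem_empty g hg
    rw [hempty]
    exact ⟨⟨fun h => (hex ⟨k, _, ‹_›, ‹_›, h⟩).elim, fun h => (Set.not_nonempty_empty h).elim⟩,
      fun z hz => (Set.notMem_empty z hz).elim⟩
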